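/- **Setting.** Let $S^{d-1}$ be the unit sphere of $\mathbb{R}^d$. A *slowly decaying kernel* is a kernel $K(x,x')=\sum_{k\ge 0} b_k (x\cdot x')^k$ on the unit spheres, where $\sum_k b_k$ converges and, for some $c>0$, $b_k\ge c/(k+1)^2$ for all $k\ge 0$. A *loss* is a measurable function $L:\mathbb{R}\times\mathbb{R}\to[0,\infty)$ with $L(y,y)=0$ such that $L(y,\cdot)$ is $1$-Lipschitz for every $y$. Given a function $f$ on $S^{d-1}$, a learning algorithm, a distribution $\mathcal{D}$ on $S^{d-1}$, $\varepsilon>0$ and $\delta\in(0,1)$, we say that $n$ examples *suffice* if, from $n$ i.i.d. examples $(x_i,f(x_i))$ with $x_i\sim\mathcal D$, the algorithm produces with probability greater than $1-\delta$ a model $\hat f$ with $\mathbb{E}_{x\sim\mathcal{D}}[L(f(x),\hat f(x))]<\varepsilon$. The *sample complexity* $n_{f,\mathcal{D}}(\varepsilon,\delta)$ is the least $N$ such that all $n\ge N$ suffice. The function $f$ is *efficiently learned* with respect to a constant $C>0$, with complexity $M$, if $$n_{f,\mathcal{D}}(\varepsilon,\delta)\le C\,\frac{M+\log(1/\delta)}{\varepsilon^2}\qquad\text{for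 all }\varepsilon>0,\ \delta\in(0,1)\text{ and all distributions }\mathcal{D}\text{ on }S^{d-1}.$$ Two kinds of models with kernel $K$ are considered. 1. *Kernel learning*: the model is the interpolant $\hat f=\sum_j\alpha_jK(x_j,\cdot)$ of the examples (the interpolant of minimal norm in the reproducing kernel Hilbert space of $K$). 2. *Wide two-layer networks*: the model is $\hat f(x)=\frac1{\sqrt m}\sum_{r=1}^m w_r\,\sigma(v_r\cdot x+c_r)$, where $\sigma$ is measurable, the $(v_r,c_r)$ are i.i.d. with a law such that $\mathbb{E}[\sigma(v\cdot x+c)\,\sigma(v\cdot x'+c)]=K(x,x')$ for all $x,x'\in S^{d-1}$, and the upper layer $w$ is trained from $w=0$ by stochastic gradient descent on the squared error of the examples, which are visited in an arbitrary order in each epoch. Here "suffice" means: if the width $m$ is sufficiently large, then the learning rate sufficiently small, then the number of epochs sufficiently large, the probability (over the examples and the random hidden layer) that the error is less than $\varepsilon$ is greater than $1-\delta$, whatever the orders of the examples in the epochs. **Theorem.** (a) The neural tangent kernel of the two-layer ReLU network with bias, $$K(x,x')=\frac{x\cdot x'+1}{4\pi}\Bigl(\pi-\arccos\Bigl(\frac{x\cdot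 x'+1}{2}\Bigr)\Bigr),$$ is slowly decaying. (b) Let $K$ be a slowly decaying kernel and $B\in\mathbb{R}$. There is a constant $C>0$, depending only on $K$ and $B$, with the following property. Let $g(y)=\sum_k a_ky^k$ be analytic on $|y|<R_g$ (with $R_g>0$), let $d\in\mathbb{N}$ and $\boldsymbol\beta\in\mathbb{R}^d$ with $\beta:=\|\boldsymbol\beta\|_2<R_g$, and put $\tilde g(y)=\sum_k|a_k|y^k$. Then $\tilde g$ is differentiable at $\beta$; put $$\sqrt{M_g}=\beta\,\tilde g'(\beta)+\tilde g(0).$$ * For every loss $L\le B$, the function $x\mapsto g(\boldsymbol\beta\cdot x)$ on $S^{d-1}$ is efficiently learned with respect to $C$, with complexity $M_g$, both by kernel learning with $K$ and by wide two-layer networks with kernel $K$. * For every loss $L$, bounded or not, and both kinds of models, $n_{g(\boldsymbol\beta\cdot x),\mathcal{D}}(\varepsilon,\delta)\le C\,M_g\,(1+\log(1/\delta))/\varepsilon^2$ for all $\varepsilon>0$, $\delta\in(0,1)$ and all distributions $\mathcal{D}$ on $S^{d-1}$. In particular, for fixed $\delta$, $O\bigl((\beta\tilde g'(\beta)+\tilde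 g(0))^2/\varepsilon^2\bigr)$ examples suffice. -/

import Mathlib

open MeasureTheory
open scoped ENNReal

noncomputable section

/-! ## Sample complexity of learning -/

/-- A `1`-Lipschitz loss: `L y z` is the loss incurred by predicting `z` when the true value
is `y`. It is nonnegative, vanishes on exact predictions, and is `1`-Lipschitz in the prediction. -/
structure IsLoss (L : ℝ → ℝ → ℝ) : Prop where
  measurable : Measurable (Function.uncurry L)
  nonneg : ∀ y z, 0 ≤ L y z
  self : ∀ y, L y y = 0
  lipschitz : ∀ y, LipschitzWith 1 (L y)

/-- The generalization error `E_{x ∼ D} [L (f x) (fhat x)]` of the trained model `fhat`. -/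
def risk {X : Type*} [MeasurableSpace X] (L : ℝ → ℝ → ℝ) (D : Measure X) (f fhat : X → ℝ) :
    ℝ≥0∞ :=
  ∫⁻ x, ENNReal.ofReal (L (f x) (fhat x)) ∂D

/-- The random trained model `fhat θ`, where `θ ∼ Q` is all the randomness involved in training,
has generalization error less than `ε` with probability greater than `1 - δ`: the failure
probability is less than `δ`. -/
def Succeeds {X Θ : Type*} [MeasurableSpace X] [MeasurableSpace Θ] (Q : Measure Θ)
    (fhat : Θ → X → ℝ) (L : ℝ → ℝ → ℝ) (D : Measure X) (f : X → ℝ) (ε δ : ℝ) : Prop :=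
  Q {θ | ENNReal.ofReal ε ≤ risk L D f (fhat θ)} < ENNReal.ofReal δ

/-- The least `N` such that every number `n ≥ N` of examples is sufficient (`⊤` if there is
none). In particular `N` examples are sufficient, so that this is at least the least
sufficient number of examples. -/
def sampleComplexity (suffices_ : ℕ → Prop) : ℕ∞ :=
  ⨅ (N : ℕ) (_ : ∀ n ≥ N, suffices_ n), (N : ℕ∞)

/-- For every input distribution `D`, every accuracy `ε` and every confidence parameter `δ`, the
sample complexity is at most `bound ε δ`. Here `learns D ε δ n` says that `n` i.i.d. examples with
inputs drawn from `D` are sufficient for the parameters `ε`, `δ`. -/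
def HasSampleBound {X : Type*} [MeasurableSpace X]
    (learns : Measure X → ℝ → ℝ → ℕ → Prop) (bound : ℝ → ℝ → ℝ) : Prop :=
  ∀ (D : Measure X), IsProbabilityMeasure D → ∀ ε δ : ℝ, 0 < ε → 0 < δ → δ < 1 →
    (sampleComplexity (learns D ε δ) : ℝ≥0∞) ≤ ENNReal.ofReal (bound ε δ)

/-- Efficient learnability with respect to the constant `C`, with complexity `M`. -/
def EfficientlyLearned {X : Type*} [MeasurableSpace X]
    (learns : Measure X → ℝ → ℝ → ℕ → Prop) (C M : ℝ) : Prop :=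
  HasSampleBound learns (fun ε δ => C * ((M + Real.log δ⁻¹) / ε ^ 2))

/-! ## Kernel models on the sphere -/

/-- The unit sphere of `ℝ^d`. -/
abbrev UnitSphere (d : ℕ) : Type := Metric.sphere (0 : EuclideanSpace ℝ (Fin d)) 1

/-- The profile `t ↦ ∑ₖ bₖ tᵏ` of the kernel `K(x, x') = ∑ₖ bₖ (x ⬝ x')ᵏ`. -/
def kernelProfile (b : ℕ → ℝ) (t : ℝ) : ℝ := ∑' k, b k * t ^ k

/-- The kernel `K(x, x') = ∑ₖ bₖ (x ⬝ x')ᵏ` on the unit sphere. -/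
def dotKernel (b : ℕ → ℝ) {d : ℕ} (x x' : UnitSphere d) : ℝ :=
  kernelProfile b (inner ℝ (x : EuclideanSpace ℝ (Fin d)) (x' : EuclideanSpace ℝ (Fin d)))

/-- Slowly decaying kernels: the series converges on the sphere and `bₖ = Ω(k⁻²)`
(`k + 1` instead of `k`, so that the condition makes sense for `k = 0`). -/
structure SlowlyDecaying (b : ℕ → ℝ) : Prop where
  summable : Summable b
  lower : ∃ c : ℝ, 0 < c ∧ ∀ k : ℕ, c / ((k : ℝ) + 1) ^ 2 ≤ b k

/-- The profile of the neural tangent kernel of the two-layer ReLU network fed with the input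
`(x/√2, 1/√2)`, as a function of `t = x ⬝ x'`. -/
def reluBiasNTK (t : ℝ) : ℝ :=
  (t + 1) / (4 * Real.pi) * (Real.pi - Real.arccos ((t + 1) / 2))

/-- The vector `α` are the coefficients of an interpolant `∑ⱼ αⱼ K(xⱼ, ·)` of the data. -/
def IsInterpolating (b : ℕ → ℝ) {d n : ℕ} (x : Fin n → UnitSphere d) (y α : Fin n → ℝ) : Prop :=
  ∀ i, ∑ j, α j * dotKernel b (x j) (x i) = y i

open Classical in
/-- Kernel learning (ridgeless kernel regression): the interpolant `∑ⱼ αⱼ K(xⱼ, ·)` of the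
examples `(xᵢ, yᵢ)`, which is the interpolant of minimal norm in the reproducing kernel Hilbert
space of `K`. As `K` is positive semidefinite, it does not depend on the solution `α` of the linear
system, and for an invertible Gram matrix `H` it is `k(x)ᵀ H⁻¹ y`. (Inconsistent data, on which
the model is `0`, do not occur for noiseless labels and kernels with positive coefficients.) -/
def kernelModel (b : ℕ → ℝ) {d n : ℕ} (x : Fin n → UnitSphere d) (y : Fin n → ℝ) :
    UnitSphere d → ℝ :=
  if h : ∃ α, IsInterpolating b x y α then fun z => ∑ j, h.choose j * dotKernel b (x j) z else 0

/-- Kernel learning with the kernel `K` learns `f` from `n` i.i.d. examples. -/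
def KernelLearns (b : ℕ → ℝ) {d : ℕ} (L : ℝ → ℝ → ℝ) (f : UnitSphere d → ℝ)
    (D : Measure (UnitSphere d)) (ε δ : ℝ) (n : ℕ) : Prop :=
  Succeeds (Measure.pi fun _ : Fin n => D) (fun x => kernelModel b x (fun i => f (x i))) L D f ε δ

/-! ## Wide two-layer networks -/

/-- The output of the hidden unit with activation `σ` and weight and bias `v`. -/
def hiddenUnit {d : ℕ} (σ : ℝ → ℝ) (v : EuclideanSpace ℝ (Fin d) × ℝ) (x : UnitSphere d) : ℝ :=
  σ (inner ℝ v.1 (x : EuclideanSpace ℝ (Fin d)) + v.2)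

/-- The (normalized) activations of the hidden layer of a network of width `m`. -/
def hiddenLayer {d m : ℕ} (σ : ℝ → ℝ) (V : Fin m → EuclideanSpace ℝ (Fin d) × ℝ)
    (x : UnitSphere d) (r : Fin m) : ℝ :=
  hiddenUnit σ (V r) x / Real.sqrt m

/-- The kernel `E[h hᵀ]` of the random hidden layer with activation `σ` and weights and biases
of law `ν` is `K(x, x') = ∑ₖ bₖ (x ⬝ x')ᵏ`. -/
def HasNNGPKernel {d : ℕ} (σ : ℝ → ℝ) (ν : Measure (EuclideanSpace ℝ (Fin d) × ℝ)) (b : ℕ → ℝ) :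
    Prop :=
  ∀ x x' : UnitSphere d, Integrable (fun v => hiddenUnit σ v x * hiddenUnit σ v x') ν ∧
    ∫ v, hiddenUnit σ v x * hiddenUnit σ v x' ∂ν = dotKernel b x x'

/-- One step of stochastic gradient descent with learning rate `η`, on the squared error
`(w ⬝ hᵢ - yᵢ)² / 2` of the `i`-th example. -/
def sgdStep {n m : ℕ} (η : ℝ) (h : Fin n → Fin m → ℝ) (y : Fin n → ℝ) (w : Fin m → ℝ) (i : Fin n) :
    Fin m → ℝ :=
  fun r => w r - η * ((∑ s, w s * h i s) - y i) * h i r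

/-- `T` epochs of stochastic gradient descent from `w = 0`, where in epoch number `t` the
examples are visited in the order `order t 0, order t 1, …`. -/
def sgd {n m : ℕ} (η : ℝ) (h : Fin n → Fin m → ℝ) (y : Fin n → ℝ)
    (order : ℕ → Equiv.Perm (Fin n)) : ℕ → Fin m → ℝ
  | 0 => 0
  | t + 1 => ((List.finRange n).map (order t)).foldl (sgdStep η h y) (sgd η h y order t)

/-- The two-layer network with hidden weights `V`, the upper layer of which is trained on the
examples `(xᵢ, yᵢ)` by `T` epochs of stochastic gradient descent. -/
def networkModel {d n m : ℕ} (σ : ℝ → ℝ) (V : Fin m → EuclideanSpace ℝ (Fin d) × ℝ) (η : ℝ)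
    (order : ℕ → Equiv.Perm (Fin n)) (T : ℕ) (x : Fin n → UnitSphere d) (y : Fin n → ℝ) :
    UnitSphere d → ℝ :=
  fun z => ∑ r, sgd η (fun i => hiddenLayer σ V (x i)) y order T r * hiddenLayer σ V z r

/-- Two-layer networks with random hidden layer learn `f` from `n` i.i.d. examples, if the width
is sufficiently large, the learning rate is sufficiently small, and the training of the upper
layer is sufficiently long; the probability is over the examples and the hidden weights, and
the examples may be visited in any order in each epoch. -/
def NetworkLearns {d : ℕ} (σ : ℝ → ℝ) (ν : Measure (EuclideanSpace ℝ (Fin d) × ℝ))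
    (L : ℝ → ℝ → ℝ) (f : UnitSphere d → ℝ) (D : Measure (UnitSphere d)) (ε δ : ℝ) (n : ℕ) : Prop :=
  ∃ m₀ : ℕ, ∀ m ≥ m₀, ∃ η₀ > (0 : ℝ), ∀ η : ℝ, 0 < η → η ≤ η₀ → ∃ T₀ : ℕ, ∀ T ≥ T₀,
    ∀ order : ℕ → Equiv.Perm (Fin n),
      Succeeds ((Measure.pi fun _ : Fin m => ν).prod (Measure.pi fun _ : Fin n => D))
        (fun θ => networkModel σ θ.1 η order T θ.2 (fun i => f (θ.2 i))) L D f ε δ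

/-! ## The auxiliary function of a power series -/

/-- The auxiliary function `g̃(y) = ∑ₖ |aₖ| yᵏ`, where the `aₖ` are the coefficients of `p`. -/
def tildeFun (p : FormalMultilinearSeries ℝ ℝ ℝ) (y : ℝ) : ℝ := ∑' k, |p.coeff k| * y ^ k

/-- The quantity `β g̃'(β) + g̃(0)`. -/
def sqrtM (p : FormalMultilinearSeries ℝ ℝ ℝ) (β : ℝ) : ℝ :=
  β * deriv (tildeFun p) β + tildeFun p 0

end

/-!
For part (a), write `s = (1 + t) / 2`. The kernel is `(1 + t) / 8 + s * arcsin s / (2 π)`, and the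
expansion of `arcsin` has nonnegative coefficients of order `j^(-3/2)` at `s ^ (2 j + 1)`. Expanding
the powers of `s`, one term of `s * arcsin s` suffices to bound the coefficient of `tᵏ` from below
by a multiple of `k^(-2)` (`one_div_le_tsum_arcsinTerm`).

For part (b), let `φ` be the feature map of the kernel by tensor powers. The function
`f x = g (β ⬝ x)` is `⟪a, φ x⟫` for a vector with `‖a‖² ≤ 4 M / c`, since `bₖ ≥ c / (k + 1)²` and
`∑ (k + 1) |aₖ| βᵏ ≤ 2 (β g̃'(β) + g̃(0))` (`exists_featureMap`).

*Kernel learning.* The interpolant is the projection of `a` to the span of the features of the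
examples. Its error is therefore given by a vector `v` with `‖v‖ ≤ ‖a‖` that is orthogonal to all
`φ (xⱼ)`, and it has to be shown that with high probability all such vectors have a small expected
truncated error (`measure_exists_orthogonal_le`). This is uniform convergence over a ball of a
Hilbert space with the dimension-free rate `‖a‖ κ / √n`, where `κ² = K(x, x)`. Instead of Rademacher
averages, the proof removes the examples one at a time: averaging the functional
`u ↦ maxᵢ (uᵢ + wᵢ)` over an example preserves the properties `IsMaxLike`, which are what
symmetrization and contraction by a Lipschitz function need (`IsMaxLike.integral_mean_sub_le`). The
expectation is then bounded by the parallelogram law (`iterAverage_maxFun_inner_le`), the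
exponential moments by Hoeffding's lemma (`lintegral_exp_sum_le`). For unbounded losses the errors
are at most `‖a‖ κ`, which replaces the bound for the loss.

*Networks.* Every number of examples that suffices for kernel learning suffices for networks with the
same kernel (`NetworkLearns.of_kernelLearns`). For a fixed sample for which the kernel model
succeeds, the random kernel of the hidden layer converges in `L¹` to its mean. The Gram matrix may be
singular, but its kernel is almost surely contained in the one of the random Gram matrix, so that
the interpolation problem has a solution that depends continuously on the random matrix
(`exists_perturbed_solution`). For small learning rates, each epoch of stochastic gradient descent is
a contraction of the error in the span of the hidden layers of the examples, so that the upper layer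
converges to the interpolant of minimal norm for every order of the examples
(`sgd_eventually_close`). Thus the trained network finally succeeds with a probability over the
hidden layer that tends to `1` (`tendsto_measure_not_eventually_risk_lt`). Dominated convergence over
the samples and the reverse Fatou lemma for the limits of the learning rate and of the number of
epochs give the claim, since the failure probability of kernel learning is strictly below `δ`
(`eventually_measure_prod_lt`).
-/

noncomputable section

/-! ### The neural tangent kernel of the ReLU network with bias -/

/-- The `n`-th Taylor coefficient `(2n choose n) / 4ⁿ` of `(1 - x)^(-1/2)`. -/
def invSqrtCoeff (n : ℕ) : ℝ := (n.centralBinom : ℝ) / 4 ^ n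

lemma invSqrtCoeff_nonneg (n : ℕ) : 0 ≤ invSqrtCoeff n := by
  unfold invSqrtCoeff; positivity

lemma invSqrtCoeff_succ (n : ℕ) :
    ((n : ℝ) + 1) * invSqrtCoeff (n + 1) = ((n : ℝ) + 1 / 2) * invSqrtCoeff n := by
  have h : ((n : ℝ) + 1) * ((n + 1).centralBinom : ℝ) = 2 * (2 * n + 1) * n.centralBinom := by
    exact_mod_cast Nat.succ_mul_centralBinom_succ n
  unfold invSqrtCoeff
  rw [pow_succ]
  field_simp
  linear_combination 2 * h

/-- The lower bound `1 / (2 √n)` for the coefficients with `n ≥ 1`. -/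
lemma one_le_mul_invSqrtCoeff_sq (n : ℕ) :
    1 ≤ 4 * ((n : ℝ) + 1) * invSqrtCoeff (n + 1) ^ 2 := by
  induction n with
  | zero => norm_num [invSqrtCoeff, Nat.centralBinom_eq_two_mul_choose, Nat.choose]
  | succ n ih =>
    have h := invSqrtCoeff_succ (n + 1)
    push_cast at h ⊢
    set x := invSqrtCoeff (n + 1)
    set y := invSqrtCoeff (n + 1 + 1)
    have hn : (0 : ℝ) ≤ n := by positivity
    have hy : y = ((n : ℝ) + 3 / 2) / (n + 2) * x := by
      field_simp
      linear_combination 2 * h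
    rw [hy]
    have : 4 * ((n : ℝ) + 1 + 1) * (((n : ℝ) + 3 / 2) / (n + 2) * x) ^ 2
        = (((n : ℝ) + 3 / 2) ^ 2 / ((n + 2) * (n + 1))) * (4 * (n + 1) * x ^ 2) := by
      field_simp
      ring
    rw [this]
    refine one_le_mul_of_one_le_of_one_le ?_ ih
    rw [one_le_div (by positivity)]
    nlinarith

lemma choose_eq_invSqrtCoeff (n : ℕ) :
    Ring.choose ((1 / 2 : ℝ) + n - 1) n = invSqrtCoeff n := by
  rw [← Ring.multichoose_eq]
  have h : ∀ n : ℕ, (n.factorial : ℝ) * invSqrtCoeff n = (ascPochhammer ℕ n).smeval (1 / 2 : ℝ) := by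
    intro n
    induction n with
    | zero => simp [invSqrtCoeff]
    | succ n ih =>
      rw [ascPochhammer_succ_right, Polynomial.smeval_mul, ← ih, Nat.factorial_succ]
      simp [Polynomial.smeval_add, Polynomial.smeval_natCast]
      linear_combination (n.factorial : ℝ) * invSqrtCoeff_succ n
  have h2 := Ring.factorial_nsmul_multichoose_eq_ascPochhammer (1 / 2 : ℝ) n
  rw [← h n, nsmul_eq_mul] at h2
  exact mul_left_cancel₀ (by positivity) h2

lemma hasSum_invSqrtCoeff {x : ℝ} (hx : |x| < 1) :
    HasSum (fun n => invSqrtCoeff n * x ^ n) (1 / √(1 - x)) := by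
  have h := (Real.one_div_one_sub_rpow_hasFPowerSeriesOnBall_zero (1 / 2)).hasSum (y := x)
    (by simpa [enorm_eq_nnnorm, ← NNReal.coe_lt_one] using hx)
  have hc : ∀ n : ℕ, Ring.choose ((2 : ℝ)⁻¹ + n - 1) n = invSqrtCoeff n := fun n => by
    rw [← choose_eq_invSqrtCoeff, one_div]
  simpa [FormalMultilinearSeries.ofScalars_apply_eq, hc, Real.sqrt_eq_rpow, mul_comm] using h

/-- The expansion of `arcsin` in the interior, by termwise integration of the one of its derivative
`(1 - s²)^(-1/2)`. -/
lemma hasSum_arcsin_of_lt {s : ℝ} (hs0 : 0 ≤ s) (hs : s < 1) :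
    HasSum (fun n => invSqrtCoeff n / (2 * n + 1) * s ^ (2 * n + 1)) (Real.arcsin s) := by
  obtain ⟨r, hsr, hr⟩ := exists_between hs
  have hr0 : 0 < r := hs0.trans_lt hsr
  have hsq : ∀ y ∈ Set.Ioo (-r) r, |y ^ 2| < 1 := fun y hy => by
    rw [abs_of_nonneg (sq_nonneg y), sq_lt_one_iff_abs_lt_one, abs_lt]
    exact ⟨by linarith [hy.1], by linarith [hy.2]⟩
  have hu : Summable fun n => invSqrtCoeff n * (r ^ 2) ^ n :=
    (hasSum_invSqrtCoeff (x := r ^ 2) (by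
      rw [abs_of_nonneg (sq_nonneg r), sq_lt_one_iff_abs_lt_one, abs_lt]
      constructor <;> linarith)).summable
  have hg : ∀ (n : ℕ) (y : ℝ), HasDerivAt (fun y => invSqrtCoeff n / (2 * n + 1) * y ^ (2 * n + 1))
      (invSqrtCoeff n * (y ^ 2) ^ n) y := fun n y => by
    refine ((hasDerivAt_pow (2 * n + 1) y).const_mul (invSqrtCoeff n / (2 * n + 1))).congr_deriv ?_
    push_cast
    rw [← pow_mul]
    field_simp
  have hbd : ∀ (n : ℕ) (y : ℝ), y ∈ Set.Ioo (-r) r →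
      ‖invSqrtCoeff n * (y ^ 2) ^ n‖ ≤ invSqrtCoeff n * (r ^ 2) ^ n := fun n y hy => by
    rw [Real.norm_of_nonneg (mul_nonneg (invSqrtCoeff_nonneg n) (by positivity))]
    refine mul_le_mul_of_nonneg_left ?_ (invSqrtCoeff_nonneg n)
    exact pow_le_pow_left₀ (sq_nonneg _) (sq_le_sq' (by linarith [hy.1]) hy.2.le) _
  have h0 : (0 : ℝ) ∈ Set.Ioo (-r) r := ⟨by linarith, hr0⟩
  have hsum0 : Summable fun n : ℕ => invSqrtCoeff n / (2 * n + 1) * (0 : ℝ) ^ (2 * n + 1) := by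
    simp [summable_zero]
  have hsm : s ∈ Set.Ioo (-r) r := ⟨by linarith, hsr⟩
  have hsums := summable_of_summable_hasDerivAt_of_isPreconnected hu isOpen_Ioo isPreconnected_Ioo
    (fun n y _ => hg n y) hbd h0 hsum0 hsm
  have hder : ∀ y ∈ Set.Ioo (-r) r, HasDerivAt
      (fun z => (∑' n : ℕ, invSqrtCoeff n / (2 * n + 1) * z ^ (2 * n + 1)) - Real.arcsin z) 0 y :=
    fun y hy => by
    have h1 := hasDerivAt_tsum_of_isPreconnected hu isOpen_Ioo isPreconnected_Ioo
      (fun n y _ => hg n y) hbd h0 hsum0 hy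
    rw [(hasSum_invSqrtCoeff (hsq y hy)).tsum_eq] at h1
    have h2 := Real.hasDerivAt_arcsin (x := y) (by linarith [hy.1]) (by linarith [hy.2])
    exact (h1.sub h2).congr_deriv (by simp)
  have hconst := isOpen_Ioo.is_const_of_deriv_eq_zero isPreconnected_Ioo
    (fun y hy => (hder y hy).differentiableAt.differentiableWithinAt)
    (fun y hy => (hder y hy).deriv) hsm h0
  simp at hconst
  have := hsums.hasSum
  rwa [show (∑' n : ℕ, invSqrtCoeff n / (2 * n + 1) * s ^ (2 * n + 1)) = Real.arcsin s by
    linarith] at this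

/-- The partial sums of the nonnegative coefficients are bounded by the values of `arcsin`. -/
lemma summable_arcsin_coeff : Summable fun n : ℕ => invSqrtCoeff n / (2 * n + 1) := by
  have hnn : ∀ n : ℕ, 0 ≤ invSqrtCoeff n / (2 * n + 1) := fun n =>
    div_nonneg (invSqrtCoeff_nonneg n) (by positivity)
  refine summable_of_sum_range_le (c := Real.pi / 2) hnn fun N => ?_
  have hc : Filter.Tendsto
      (fun s : ℝ => ∑ n ∈ Finset.range N, invSqrtCoeff n / (2 * n + 1) * s ^ (2 * n + 1))
      (nhdsWithin 1 (Set.Iio 1)) (nhds (∑ n ∈ Finset.range N, invSqrtCoeff n / (2 * n + 1))) := by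
    have : Continuous fun s : ℝ =>
      ∑ n ∈ Finset.range N, invSqrtCoeff n / (2 * n + 1) * s ^ (2 * n + 1) := by fun_prop
    simpa using (this.tendsto 1).mono_left nhdsWithin_le_nhds
  refine le_of_tendsto hc ?_
  filter_upwards [Ioo_mem_nhdsLT (show (0 : ℝ) < 1 by norm_num)] with s hs
  exact ((hasSum_arcsin_of_lt hs.1.le hs.2).summable.sum_le_tsum _
    (fun n _ => mul_nonneg (hnn n) (pow_nonneg hs.1.le _))).trans
    ((hasSum_arcsin_of_lt hs.1.le hs.2).tsum_eq.trans_le (Real.arcsin_le_pi_div_two s))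

/-- As its coefficients are summable, the expansion of `arcsin` extends to the end point `1`. -/
lemma hasSum_arcsin {s : ℝ} (hs0 : 0 ≤ s) (hs : s ≤ 1) :
    HasSum (fun n => invSqrtCoeff n / (2 * n + 1) * s ^ (2 * n + 1)) (Real.arcsin s) := by
  rcases hs.lt_or_eq with h | rfl
  · exact hasSum_arcsin_of_lt hs0 h
  · have hnn : ∀ n : ℕ, 0 ≤ invSqrtCoeff n / (2 * n + 1) := fun n =>
      div_nonneg (invSqrtCoeff_nonneg n) (by positivity)
    have hcont : ContinuousOn (fun s : ℝ => ∑' n : ℕ, invSqrtCoeff n / (2 * n + 1) * s ^ (2 * n + 1))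
        (Set.Icc 0 1) := by
      refine continuousOn_tsum (fun n => by fun_prop) summable_arcsin_coeff fun n s hs => ?_
      rw [Real.norm_of_nonneg (mul_nonneg (hnn n) (pow_nonneg hs.1 _))]
      exact mul_le_of_le_one_right (hnn n) (pow_le_one₀ hs.1 hs.2)
    have h1 : Filter.Tendsto (fun s : ℝ => ∑' n : ℕ, invSqrtCoeff n / (2 * n + 1) * s ^ (2 * n + 1))
        (nhdsWithin 1 (Set.Ico 0 1)) (nhds (∑' n : ℕ, invSqrtCoeff n / (2 * n + 1) *
          (1 : ℝ) ^ (2 * n + 1))) :=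
      (hcont 1 (by simp)).mono_left (nhdsWithin_mono _ Set.Ico_subset_Icc_self)
    have h2 : Filter.Tendsto Real.arcsin (nhdsWithin 1 (Set.Ico 0 1)) (nhds (Real.arcsin 1)) :=
      (Real.continuous_arcsin.tendsto 1).mono_left nhdsWithin_le_nhds
    have hne : (nhdsWithin (1 : ℝ) (Set.Ico 0 1)).NeBot :=
      mem_closure_iff_nhdsWithin_neBot.mp (by rw [closure_Ico (by norm_num)]; simp)
    have heq := tendsto_nhds_unique (h1.congr' (by
      filter_upwards [self_mem_nhdsWithin] with s hs
      exact (hasSum_arcsin_of_lt hs.1 hs.2).tsum_eq)) h2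
    rw [← heq]
    exact Summable.hasSum (by simpa using summable_arcsin_coeff)

/-- The coefficient of `tᵏ` in the `j`-th term of the expansion of `s * arcsin s`, where
`s = (1 + t) / 2` and `(j, k)` is the argument. -/
def arcsinTerm (p : ℕ × ℕ) : ℝ :=
  invSqrtCoeff p.1 / (2 * p.1 + 1) * ((2 * p.1 + 2).choose p.2 / 4 ^ (p.1 + 1))

lemma arcsinTerm_nonneg (p : ℕ × ℕ) : 0 ≤ arcsinTerm p :=
  mul_nonneg (div_nonneg (invSqrtCoeff_nonneg _) (by positivity)) (by positivity)

lemma hasSum_choose_mul_pow (n : ℕ) (t : ℝ) :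
    HasSum (fun k => (n.choose k : ℝ) * t ^ k) ((1 + t) ^ n) := by
  have h : HasSum (fun k => (n.choose k : ℝ) * t ^ k)
      (∑ k ∈ Finset.range (n + 1), (n.choose k : ℝ) * t ^ k) :=
    hasSum_sum_of_ne_finset_zero fun k hk => by
      rw [Nat.choose_eq_zero_of_lt (by simpa [Nat.lt_succ_iff] using hk)]
      simp
  rwa [show ∑ k ∈ Finset.range (n + 1), (n.choose k : ℝ) * t ^ k = (1 + t) ^ n by
    rw [add_comm 1 t, add_pow]
    exact Finset.sum_congr rfl fun k _ => by rw [one_pow]; ring] at h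

lemma hasSum_arcsinTerm_mul_pow (j : ℕ) (t : ℝ) :
    HasSum (fun k => arcsinTerm (j, k) * t ^ k)
      ((1 + t) / 2 * (invSqrtCoeff j / (2 * j + 1) * ((1 + t) / 2) ^ (2 * j + 1))) := by
  have h := (hasSum_choose_mul_pow (2 * j + 2) t).mul_left
    (invSqrtCoeff j / (2 * j + 1) / 4 ^ (j + 1))
  have hval : (1 + t) / 2 * (invSqrtCoeff j / (2 * j + 1) * ((1 + t) / 2) ^ (2 * j + 1))
      = invSqrtCoeff j / (2 * j + 1) / 4 ^ (j + 1) * (1 + t) ^ (2 * j + 2) := by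
    rw [show (4 : ℝ) ^ (j + 1) = 2 ^ (2 * j + 2) by
      rw [show 2 * j + 2 = 2 * (j + 1) by ring, pow_mul]; norm_num]
    rw [div_pow, pow_succ (1 + t) (2 * j + 1), pow_succ (2 : ℝ) (2 * j + 1)]
    field_simp
  rw [hval]
  refine h.congr_fun fun k => ?_
  simp only [arcsinTerm]
  ring

lemma summable_arcsinTerm : Summable arcsinTerm := by
  refine (summable_prod_of_nonneg arcsinTerm_nonneg).2 ⟨fun j => ?_, ?_⟩
  · simpa using (hasSum_arcsinTerm_mul_pow j 1).summable
  · refine summable_arcsin_coeff.congr fun j => ?_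
    simpa using ((hasSum_arcsinTerm_mul_pow j 1).tsum_eq).symm

/-- The powers of `1 + t` may be expanded and rearranged, as all coefficients are nonnegative and
the double series converges at `t = 1`. -/
lemma hasSum_tsum_arcsinTerm {t : ℝ} (ht : t ∈ Set.Icc (-1 : ℝ) 1) :
    HasSum (fun k => (∑' j, arcsinTerm (j, k)) * t ^ k)
      ((1 + t) / 2 * Real.arcsin ((1 + t) / 2)) := by
  have habs : |t| ≤ 1 := abs_le.2 ht
  have hs : Summable fun p : ℕ × ℕ => arcsinTerm p * t ^ p.2 := by
    refine Summable.of_norm_bounded summable_arcsinTerm fun p => ?_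
    rw [norm_mul, norm_pow, Real.norm_of_nonneg (arcsinTerm_nonneg p), Real.norm_eq_abs]
    exact mul_le_of_le_one_right (arcsinTerm_nonneg p) (pow_le_one₀ (abs_nonneg t) habs)
  have h1 := hs.hasSum.prod_fiberwise fun j => hasSum_arcsinTerm_mul_pow j t
  have h2 := (hasSum_arcsin (s := (1 + t) / 2) (by linarith [ht.1]) (by linarith [ht.2])).mul_left
    ((1 + t) / 2)
  have htot := hs.hasSum
  rw [h1.unique h2] at htot
  have hcol : ∀ k, Summable fun j => arcsinTerm (j, k) := fun k =>
    summable_arcsinTerm.comp_injective (i := fun j => (j, k)) fun a b h => (Prod.mk.inj h).1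
  exact ((Equiv.prodComm ℕ ℕ).hasSum_iff.2 htot).prod_fiberwise fun k =>
    (hcol k).hasSum.mul_right (t ^ k)

/-- For `k ≥ 1` a single term suffices: the one of degree `2k` in `s`, whose middle coefficient in
`t` is of order `k^(-1/2)`, while the coefficient of `arcsin` is of order `k^(-3/2)`. -/
lemma one_div_le_tsum_arcsinTerm (k : ℕ) :
    1 / 8 / ((k : ℝ) + 1) ^ 2 ≤ ∑' j, arcsinTerm (j, k) := by
  have hcol : Summable fun j => arcsinTerm (j, k) :=
    summable_arcsinTerm.comp_injective (i := fun j => (j, k)) fun a b h => (Prod.mk.inj h).1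
  rcases k with _ | k
  · refine le_trans ?_ (hcol.le_tsum 0 fun j _ => arcsinTerm_nonneg _)
    norm_num [arcsinTerm, invSqrtCoeff]
  · refine le_trans ?_ (hcol.le_tsum k fun j _ => arcsinTerm_nonneg _)
    have hA := invSqrtCoeff_succ k
    have hB := one_le_mul_invSqrtCoeff_sq k
    have hterm : arcsinTerm (k, k + 1)
        = invSqrtCoeff k / (2 * k + 1) * invSqrtCoeff (k + 1) := by
      simp only [arcsinTerm]
      rw [invSqrtCoeff, invSqrtCoeff, Nat.centralBinom_eq_two_mul_choose (k + 1),
        show 2 * (k + 1) = 2 * k + 2 by ring]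
    rw [hterm]
    set x := invSqrtCoeff k
    set y := invSqrtCoeff (k + 1)
    have hk : (0 : ℝ) ≤ k := by positivity
    have hx : x = ((k : ℝ) + 1) / (k + 1 / 2) * y := by
      field_simp
      linear_combination -2 * hA
    rw [hx]
    have : ((k : ℝ) + 1) / (k + 1 / 2) * y / (2 * k + 1) * y
        = (4 * (k + 1) * y ^ 2) * (1 / (2 * (2 * k + 1) ^ 2)) := by
      field_simp
      ring
    rw [this]
    refine le_trans ?_ (le_mul_of_one_le_left (by positivity) hB)
    push_cast
    rw [div_div, div_le_div_iff₀ (by positivity) (by positivity)]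
    nlinarith

/-- With `s = (1 + t) / 2` and `arccos = π / 2 - arcsin`, the kernel is
`(1 + t) / 8 + s * arcsin s / (2 π)`. -/
lemma reluBiasNTK_slowlyDecaying : ∃ b : ℕ → ℝ, SlowlyDecaying b ∧
    ∀ t ∈ Set.Icc (-1 : ℝ) 1, HasSum (fun k => b k * t ^ k) (reluBiasNTK t) := by
  let b : ℕ → ℝ := fun k => 1 / 8 * ((1 : ℕ).choose k : ℝ) +
    1 / (2 * Real.pi) * ∑' j, arcsinTerm (j, k)
  have hb : ∀ t ∈ Set.Icc (-1 : ℝ) 1, HasSum (fun k => b k * t ^ k) (reluBiasNTK t) := by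
    intro t ht
    have h := ((hasSum_choose_mul_pow 1 t).mul_left (1 / 8)).add
      ((hasSum_tsum_arcsinTerm ht).mul_left (1 / (2 * Real.pi)))
    have hval : reluBiasNTK t = 1 / 8 * (1 + t) ^ 1 +
        1 / (2 * Real.pi) * ((1 + t) / 2 * Real.arcsin ((1 + t) / 2)) := by
      rw [reluBiasNTK, Real.arccos_eq_pi_div_two_sub_arcsin, add_comm t 1]
      have := Real.pi_pos.ne'
      field_simp
      ring
    rw [hval]
    refine h.congr_fun fun k => ?_
    simp only [b]
    ring
  refine ⟨b, ⟨by simpa using (hb 1 (by simp)).summable, 1 / (2 * Real.pi) * (1 / 8),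
    by positivity, fun k => ?_⟩, hb⟩
  have h1 := one_div_le_tsum_arcsinTerm k
  calc 1 / (2 * Real.pi) * (1 / 8) / ((k : ℝ) + 1) ^ 2
      = 1 / (2 * Real.pi) * (1 / 8 / ((k : ℝ) + 1) ^ 2) := by ring
    _ ≤ 1 / (2 * Real.pi) * ∑' j, arcsinTerm (j, k) := by gcongr
    _ ≤ b k := le_add_of_nonneg_left (by positivity)

/-! ### The auxiliary function of a power series -/

/-- The summands on the right are bounded by those of the derivative of a geometric series. -/
lemma summable_nat_mul_abs_mul_pow {a : ℕ → ℝ} {y r : ℝ} (hy : 0 ≤ y) (hyr : y < r)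
    (ha : Summable fun k => |a k| * r ^ k) : Summable fun k : ℕ => |a k| * (k * y ^ (k - 1)) := by
  have hr : 0 < r := hy.trans_lt hyr
  obtain ⟨A, hA⟩ := ha.tendsto_atTop_zero.bddAbove_range
  have hgeo : Summable fun k : ℕ => (k : ℝ) ^ 1 * (y / r) ^ k :=
    summable_pow_mul_geometric_of_norm_lt_one 1 (by
      rw [Real.norm_of_nonneg (by positivity), div_lt_one hr]
      exact hyr)
  rw [← summable_nat_add_iff 1]
  have hgeo' : Summable fun k : ℕ => ((k : ℝ) + 1) * (y / r) ^ k := by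
    refine (hgeo.add (summable_geometric_of_lt_one (r := y / r) (by positivity)
      ((div_lt_one hr).2 hyr))).congr fun k => ?_
    ring
  refine Summable.of_nonneg_of_le (fun k => by positivity) (fun k => ?_) (hgeo'.mul_left (A / r))
  have hAk : |a (k + 1)| * r ^ (k + 1) ≤ A := hA ⟨k + 1, rfl⟩
  have : |a (k + 1)| ≤ A / r ^ (k + 1) := by rwa [le_div_iff₀ (by positivity)]
  calc |a (k + 1)| * (((k + 1 : ℕ) : ℝ) * y ^ (k + 1 - 1))
      ≤ A / r ^ (k + 1) * (((k + 1 : ℕ) : ℝ) * y ^ (k + 1 - 1)) := by gcongr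
    _ = A / r * (((k : ℝ) + 1) * (y / r) ^ k) := by
      rw [Nat.add_sub_cancel, div_pow, pow_succ]
      push_cast
      field_simp

lemma hasDerivAt_tsum_abs_mul_pow {a : ℕ → ℝ} {y r : ℝ} (hy : 0 ≤ y) (hyr : y < r)
    (ha : Summable fun k => |a k| * r ^ k) :
    HasDerivAt (fun z => ∑' k, |a k| * z ^ k) (∑' k : ℕ, |a k| * (k * y ^ (k - 1))) y := by
  obtain ⟨r', hyr', hr'r⟩ := exists_between hyr
  have hr' : 0 < r' := hy.trans_lt hyr'
  refine hasDerivAt_tsum_of_isPreconnected (summable_nat_mul_abs_mul_pow hr'.le hr'r ha)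
    (isOpen_Ioo (a := -r') (b := r')) isPreconnected_Ioo
    (fun k z _ => (hasDerivAt_pow k z).const_mul |a k|) (fun k z hz => ?_)
    (y₀ := 0) ⟨by linarith, hr'⟩ ?_ ⟨by linarith, hyr'⟩
  · have hz' : |z| ≤ r' := abs_le.2 ⟨hz.1.le, hz.2.le⟩
    rw [norm_mul, norm_mul, norm_pow, Real.norm_eq_abs, Real.norm_eq_abs, Real.norm_eq_abs,
      abs_abs, Nat.abs_cast]
    gcongr
  · exact summable_of_ne_finset_zero (s := {0}) fun k hk => by
      rw [zero_pow (by simpa using hk), mul_zero]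

lemma summable_abs_coeff_mul_pow {p : FormalMultilinearSeries ℝ ℝ ℝ} {r : ℝ} (hr0 : 0 ≤ r)
    (hr : ENNReal.ofReal r < p.radius) : Summable fun k => |p.coeff k| * r ^ k := by
  have h := p.summable_norm_mul_pow (r := r.toNNReal) hr
  refine h.congr fun k => ?_
  rw [FormalMultilinearSeries.norm_apply_eq_norm_coef, Real.coe_toNNReal r hr0, Real.norm_eq_abs]

lemma exists_gt_summable_abs_coeff {g : ℝ → ℝ} {p : FormalMultilinearSeries ℝ ℝ ℝ} {R : ℝ≥0∞}
    (hg : HasFPowerSeriesOnBall g p 0 R) {y : ℝ} (hy0 : 0 ≤ y) (hy : ENNReal.ofReal y < R) :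
    ∃ r, y < r ∧ Summable fun k => |p.coeff k| * r ^ k := by
  obtain ⟨r, hyr, hrR⟩ := ENNReal.lt_iff_exists_nnreal_btwn.1 hy
  refine ⟨r, by simpa [hy0] using (ENNReal.ofReal_lt_coe_iff hy0).1 hyr, ?_⟩
  exact summable_abs_coeff_mul_pow r.2 (by simpa using hrR.trans_le hg.r_le)

lemma tildeFun_differentiableAt {g : ℝ → ℝ} {p : FormalMultilinearSeries ℝ ℝ ℝ} {R : ℝ≥0∞}
    (hg : HasFPowerSeriesOnBall g p 0 R) {y : ℝ} (hy0 : 0 ≤ y) (hy : ENNReal.ofReal y < R) :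
    DifferentiableAt ℝ (tildeFun p) y := by
  obtain ⟨r, hyr, hr⟩ := exists_gt_summable_abs_coeff hg hy0 hy
  exact (hasDerivAt_tsum_abs_mul_pow hy0 hyr hr).differentiableAt

/-- The sum `∑ (k + 1) |aₖ| yᵏ`, which dominates the norm of `x ↦ g (β ⬝ x)` in the reproducing
kernel Hilbert space of a slowly decaying kernel, is at most `2 (y g̃'(y) + g̃(0))`. -/
lemma tsum_succ_mul_abs_coeff_le_sqrtM {g : ℝ → ℝ} {p : FormalMultilinearSeries ℝ ℝ ℝ}
    {R : ℝ≥0∞} (hg : HasFPowerSeriesOnBall g p 0 R) {y : ℝ} (hy0 : 0 ≤ y)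
    (hy : ENNReal.ofReal y < R) :
    (Summable fun k : ℕ => ((k : ℝ) + 1) * |p.coeff k| * y ^ k) ∧
      ∑' k : ℕ, ((k : ℝ) + 1) * |p.coeff k| * y ^ k ≤ 2 * sqrtM p y := by
  obtain ⟨r, hyr, hr⟩ := exists_gt_summable_abs_coeff hg hy0 hy
  have hD := hasDerivAt_tsum_abs_mul_pow hy0 hyr hr
  have hS := (summable_nat_mul_abs_mul_pow hy0 hyr hr).mul_left y
  have hpow : ∀ k : ℕ, y * (|p.coeff k| * (k * y ^ (k - 1))) = k * |p.coeff k| * y ^ k := by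
    intro k
    rcases k with _ | k
    · simp
    · rw [Nat.add_sub_cancel, pow_succ]; ring
  have hS' : Summable fun k : ℕ => (k : ℝ) * |p.coeff k| * y ^ k := hS.congr hpow
  have hZ : HasSum (fun k => |p.coeff k| * (0 : ℝ) ^ k) |p.coeff 0| := by
    simpa using hasSum_single (f := fun k => |p.coeff k| * (0 : ℝ) ^ k) 0 fun k hk => by
      rw [zero_pow hk, mul_zero]
  have h0 : sqrtM p y = (∑' k : ℕ, (k : ℝ) * |p.coeff k| * y ^ k)
      + ∑' k, |p.coeff k| * (0 : ℝ) ^ k := by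
    rw [sqrtM, show deriv (tildeFun p) y = _ from hD.deriv, ← tsum_mul_left]
    simp_rw [hpow]
    rfl
  have hle : ∀ k : ℕ, ((k : ℝ) + 1) * |p.coeff k| * y ^ k ≤
      2 * ((k : ℝ) * |p.coeff k| * y ^ k + |p.coeff k| * (0 : ℝ) ^ k) := by
    intro k
    rcases k with _ | k
    · simp only [CharP.cast_eq_zero, zero_mul, zero_add, pow_zero, one_mul, mul_one]
      linarith [abs_nonneg (p.coeff 0)]
    · have : 0 ≤ |p.coeff (k + 1)| * y ^ (k + 1) := by positivity
      rw [zero_pow (by simp), mul_zero, add_zero]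
      push_cast
      nlinarith [mul_nonneg (Nat.cast_nonneg (α := ℝ) k) this]
  have hS2 := (hS'.add hZ.summable).mul_left 2
  have hsum : Summable fun k : ℕ => ((k : ℝ) + 1) * |p.coeff k| * y ^ k :=
    Summable.of_nonneg_of_le (fun k => by positivity) hle hS2
  refine ⟨hsum, ?_⟩
  rw [h0, ← hS'.tsum_add hZ.summable, ← tsum_mul_left]
  exact hsum.tsum_le_tsum hle hS2

/-! ### Uniform convergence over a ball of a Hilbert space -/

/-- Functionals on `ℝ^ι` that behave like averages of the functionals
`u ↦ maxᵢ (uᵢ + wᵢ)`: the property `contraction` is the one step of the contraction inequality for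
Rademacher averages. -/
structure IsMaxLike {ι : Type*} (m : (ι → ℝ) → ℝ) : Prop where
  mono : Monotone m
  add_const : ∀ (u : ι → ℝ) (c : ℝ), m (u + fun _ => c) = m u + c
  convex : ConvexOn ℝ Set.univ m
  contraction : ∀ u p q : ι → ℝ, (∀ i j, |p i - p j| ≤ |q i - q j|) →
    m (u + p) + m (u - p) ≤ m (u + q) + m (u - q)

/-- The maximum of finitely many reals. -/
def maxFun {ι : Type*} [Fintype ι] [Nonempty ι] (u : ι → ℝ) : ℝ :=
  Finset.univ.sup' Finset.univ_nonempty u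

section

variable {ι : Type*} [Fintype ι]

lemma le_maxFun [Nonempty ι] (u : ι → ℝ) (i : ι) : u i ≤ maxFun u :=
  Finset.le_sup' u (Finset.mem_univ i)

lemma maxFun_le [Nonempty ι] {u : ι → ℝ} {c : ℝ} (h : ∀ i, u i ≤ c) : maxFun u ≤ c :=
  Finset.sup'_le _ _ fun i _ => h i

lemma exists_eq_maxFun [Nonempty ι] (u : ι → ℝ) : ∃ i, maxFun u = u i := by
  obtain ⟨i, -, hi⟩ := Finset.exists_mem_eq_sup' Finset.univ_nonempty u
  exact ⟨i, hi⟩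

lemma isMaxLike_maxFun [Nonempty ι] : IsMaxLike (maxFun (ι := ι)) where
  mono u v huv := maxFun_le fun i => (huv i).trans (le_maxFun v i)
  add_const u c := by
    refine le_antisymm (maxFun_le fun i => ?_) ?_
    · simpa using le_maxFun u i
    · obtain ⟨i, hi⟩ := exists_eq_maxFun u
      rw [hi]
      exact le_maxFun (u + fun _ => c) i
  convex := ⟨convex_univ, fun u _ v _ a b ha hb _ => maxFun_le fun i =>
    add_le_add (mul_le_mul_of_nonneg_left (le_maxFun u i) ha)
      (mul_le_mul_of_nonneg_left (le_maxFun v i) hb)⟩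
  contraction u p q h := by
    obtain ⟨i, hi⟩ := exists_eq_maxFun (u + p)
    obtain ⟨j, hj⟩ := exists_eq_maxFun (u - p)
    rw [hi, hj]
    have h1 := le_of_abs_le (h i j)
    have h2 := le_maxFun (u + q)
    have h3 := le_maxFun (u - q)
    simp only [Pi.add_apply, Pi.sub_apply] at h2 h3 ⊢
    rcases abs_cases (q i - q j) with ⟨hq, _⟩ | ⟨hq, _⟩
    · linarith [h2 i, h3 j]
    · linarith [h2 j, h3 i]

lemma IsMaxLike.lipschitz {m : (ι → ℝ) → ℝ} (hm : IsMaxLike m) : LipschitzWith 1 m := by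
  refine LipschitzWith.of_le_add fun u v => ?_
  rw [← hm.add_const]
  refine hm.mono fun i => ?_
  have := le_of_abs_le ((Real.dist_eq _ _).symm.trans_le (dist_le_pi_dist u v i))
  simp only [Pi.add_apply]
  linarith

variable {X : Type*} [MeasurableSpace X] {D : Measure X} [IsProbabilityMeasure D]

lemma IsMaxLike.integrable_comp {m : (ι → ℝ) → ℝ} (hm : IsMaxLike m) {ξ : X → ι → ℝ}
    (hξ : Measurable ξ) {A : ℝ} (hA : ∀ x i, |ξ x i| ≤ A) (u : ι → ℝ) :
    Integrable (fun x => m (u + ξ x)) D := by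
  refine Integrable.of_bound
    ((hm.lipschitz.continuous.measurable.comp (hξ.const_add u)).aestronglyMeasurable)
    (|m u| + A) (Filter.Eventually.of_forall fun x => ?_)
  have h1 : m (u + ξ x) ≤ m u + A := by
    rw [← hm.add_const]
    exact hm.mono fun i => by simpa using (abs_le.1 (hA x i)).2
  have h2 : m u + -A ≤ m (u + ξ x) := by
    rw [← hm.add_const]
    exact hm.mono fun i => by simpa using (abs_le.1 (hA x i)).1
  rw [Real.norm_eq_abs, abs_le]
  constructor
  · linarith [neg_abs_le (m u)]
  · linarith [le_abs_self (m u)]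

lemma IsMaxLike.average {m : (ι → ℝ) → ℝ} (hm : IsMaxLike m) {ξ : X → ι → ℝ}
    (hξ : Measurable ξ) {A : ℝ} (hA : ∀ x i, |ξ x i| ≤ A) :
    IsMaxLike fun u => ∫ x, m (u + ξ x) ∂D where
  mono u v huv := integral_mono (hm.integrable_comp hξ hA u) (hm.integrable_comp hξ hA v)
    fun x => hm.mono (by gcongr)
  add_const u c := by
    have : ∀ x, m (u + (fun _ => c) + ξ x) = m (u + ξ x) + c := fun x => by
      rw [add_right_comm, hm.add_const]
    simp_rw [this]
    rw [integral_add (hm.integrable_comp hξ hA u) (integrable_const c)]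
    simp
  convex := by
    refine ⟨convex_univ, fun u _ v _ a b ha hb hab => ?_⟩
    simp only [smul_eq_mul]
    rw [← integral_const_mul, ← integral_const_mul, ← integral_add
      ((hm.integrable_comp hξ hA u).const_mul a) ((hm.integrable_comp hξ hA v).const_mul b)]
    refine integral_mono (hm.integrable_comp hξ hA _)
      (((hm.integrable_comp hξ hA u).const_mul a).add
        ((hm.integrable_comp hξ hA v).const_mul b)) fun x => ?_
    have h := hm.convex.2 (Set.mem_univ (u + ξ x)) (Set.mem_univ (v + ξ x)) ha hb hab
    rwa [show a • (u + ξ x) + b • (v + ξ x) = a • u + b • v + ξ x by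
      rw [smul_add, smul_add, add_add_add_comm, ← add_smul, hab, one_smul]] at h
  contraction u p q h := by
    rw [← integral_add (hm.integrable_comp hξ hA _) (hm.integrable_comp hξ hA _),
      ← integral_add (hm.integrable_comp hξ hA _) (hm.integrable_comp hξ hA _)]
    refine integral_mono ((hm.integrable_comp hξ hA _).add (hm.integrable_comp hξ hA _))
      ((hm.integrable_comp hξ hA _).add (hm.integrable_comp hξ hA _)) fun x => ?_
    have := hm.contraction (u + ξ x) p q h
    simpa only [add_right_comm, sub_add_eq_add_sub] using this

/-- Symmetrization and contraction, for one example: subtracting the loss from its mean costs no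
more than a random sign times twice the prediction. -/
lemma IsMaxLike.integral_mean_sub_le {m : (ι → ℝ) → ℝ} (hm : IsMaxLike m) {G : X → ι → ℝ}
    (hG : Measurable G) {A : ℝ} (hA : ∀ x i, |G x i| ≤ A) {ψ : ℝ → ℝ} (hψ : LipschitzWith 1 ψ)
    (hψ0 : ψ 0 = 0) (u : ι → ℝ) :
    ∫ x, m (u + fun i => (∫ z, ψ (G z i) ∂D) - ψ (G x i)) ∂D ≤
      ∫ x, (m (u + (2 : ℝ) • G x) + m (u - (2 : ℝ) • G x)) / 2 ∂D := by
  have hψabs : ∀ t, |ψ t| ≤ |t| := fun t => by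
    simpa [hψ0, Real.dist_eq] using hψ.dist_le_mul t 0
  let Ψ : X → ι → ℝ := fun x i => ψ (G x i)
  have hΨ : Measurable Ψ := measurable_pi_lambda _ fun i =>
    hψ.continuous.measurable.comp ((measurable_pi_apply i).comp hG)
  have hΨA : ∀ x i, |Ψ x i| ≤ A := fun x i => (hψabs _).trans (hA x i)
  let c : ι → ℝ := fun i => ∫ z, Ψ z i ∂D
  have h2Ψ : ∀ x i, |((2 : ℝ) • Ψ) x i| ≤ 2 * A := fun x i => by
    simpa [abs_mul] using hΨA x i
  have hn2Ψ : ∀ x i, |(-((2 : ℝ) • Ψ)) x i| ≤ 2 * A := fun x i => by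
    simpa [abs_mul] using hΨA x i
  have h2G : ∀ x i, |((2 : ℝ) • G) x i| ≤ 2 * A := fun x i => by
    simpa [abs_mul] using hA x i
  have hn2G : ∀ x i, |(-((2 : ℝ) • G)) x i| ≤ 2 * A := fun x i => by
    simpa [abs_mul] using hA x i
  have hΨi : ∀ i, Integrable (fun x => Ψ x i) D := fun i =>
    Integrable.of_bound ((measurable_pi_apply i).comp hΨ).aestronglyMeasurable A
      (Filter.Eventually.of_forall fun x => hΨA x i)
  have I1 := hm.integrable_comp (D := D) (hΨ.const_smul (2 : ℝ)) h2Ψ u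
  have I2 := hm.integrable_comp (D := D) (hΨ.const_smul (2 : ℝ)).neg hn2Ψ u
  have I3 := hm.integrable_comp (D := D) (hG.const_smul (2 : ℝ)) h2G u
  have I4 := hm.integrable_comp (D := D) (hG.const_smul (2 : ℝ)).neg hn2G u
  simp only [Pi.neg_apply, Pi.smul_apply, ← sub_eq_add_neg] at I1 I2 I3 I4
  have hcA : ∀ x i, |(c - Ψ x) i| ≤ 2 * A := fun x i => by
    have h1 : |c i| ≤ A := by
      have := norm_integral_le_of_norm_le_const (μ := D)
        (f := fun x => Ψ x i) (Filter.Eventually.of_forall fun x => hΨA x i)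
      simpa using this
    rw [Pi.sub_apply]
    exact (abs_sub _ _).trans (by linarith [hΨA x i])
  have I0 := hm.integrable_comp (D := D) (ξ := fun x => c - Ψ x) (hΨ.const_sub c) hcA u
  -- Jensen's inequality for the mean
  have hJ : m (u + (2 : ℝ) • c) ≤ ∫ x, m (u + (2 : ℝ) • Ψ x) ∂D := by
    have hint : Integrable (fun x => u + (2 : ℝ) • Ψ x) D :=
      Integrable.of_eval fun i => (integrable_const _).add ((hΨi i).const_mul 2)
    have h := hm.convex.map_integral_le (μ := D) (f := fun x => u + (2 : ℝ) • Ψ x)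
      hm.lipschitz.continuous.continuousOn isClosed_univ (by simp) hint I1
    convert h using 2
    ext i
    rw [eval_integral (f := fun x => u + (2 : ℝ) • Ψ x)
      fun i => (integrable_const _).add ((hΨi i).const_mul 2)]
    have := integral_add (μ := D) (integrable_const (u i)) ((hΨi i).const_mul 2)
    simp only [Pi.add_apply, Pi.smul_apply, smul_eq_mul] at this ⊢
    rw [this, integral_const_mul]
    simp [c]
  have hpt : ∀ x, m (u + (c - Ψ x)) ≤
      (m (u + (2 : ℝ) • c) + m (u - (2 : ℝ) • Ψ x)) / 2 := fun x => by
    have h := hm.convex.2 (Set.mem_univ (u + (2 : ℝ) • c)) (Set.mem_univ (u - (2 : ℝ) • Ψ x))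
      (by norm_num : (0 : ℝ) ≤ 1 / 2) (by norm_num : (0 : ℝ) ≤ 1 / 2) (by norm_num)
    rw [show (1 / 2 : ℝ) • (u + (2 : ℝ) • c) + (1 / 2 : ℝ) • (u - (2 : ℝ) • Ψ x)
      = u + (c - Ψ x) by ext i; simp; ring] at h
    simp only [smul_eq_mul] at h
    linarith
  calc ∫ x, m (u + (c - Ψ x)) ∂D
      ≤ ∫ x, (m (u + (2 : ℝ) • c) + m (u - (2 : ℝ) • Ψ x)) / 2 ∂D :=
        integral_mono I0 (((integrable_const _).add I2).div_const 2) hpt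
    _ = (m (u + (2 : ℝ) • c) + ∫ x, m (u - (2 : ℝ) • Ψ x) ∂D) / 2 := by
        rw [integral_div, integral_add (integrable_const _) I2]
        simp
    _ ≤ ((∫ x, m (u + (2 : ℝ) • Ψ x) ∂D) + ∫ x, m (u - (2 : ℝ) • Ψ x) ∂D) / 2 := by gcongr
    _ = ∫ x, (m (u + (2 : ℝ) • Ψ x) + m (u - (2 : ℝ) • Ψ x)) / 2 ∂D := by
        rw [integral_div, integral_add I1 I2]
    _ ≤ ∫ x, (m (u + (2 : ℝ) • G x) + m (u - (2 : ℝ) • G x)) / 2 ∂D := by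
        refine integral_mono ((I1.add I2).div_const 2) ((I3.add I4).div_const 2) fun x => ?_
        refine div_le_div_of_nonneg_right (hm.contraction u _ _ fun i j => ?_) (by norm_num)
        have := hψ.dist_le_mul (G x i) (G x j)
        simp only [Real.dist_eq, NNReal.coe_one, one_mul] at this
        simp only [Pi.smul_apply, smul_eq_mul, ← mul_sub, abs_mul]
        exact mul_le_mul_of_nonneg_left this (abs_nonneg _)

/-- The expectation of `m (u + ∑ i < n, ξ (xᵢ))` over `n` independent examples `xᵢ`. -/
def iterAverage (D : Measure X) (ξ : X → ι → ℝ) (m : (ι → ℝ) → ℝ) : ℕ → (ι → ℝ) → ℝ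
  | 0 => m
  | n + 1 => fun u => ∫ x, iterAverage D ξ m n (u + ξ x) ∂D

lemma IsMaxLike.iterAverage {m : (ι → ℝ) → ℝ} (hm : IsMaxLike m) {ξ : X → ι → ℝ}
    (hξ : Measurable ξ) {A : ℝ} (hA : ∀ x i, |ξ x i| ≤ A) (n : ℕ) :
    IsMaxLike (iterAverage D ξ m n) := by
  induction n with
  | zero => exact hm
  | succ n ih => exact ih.average hξ hA

end

section

variable {ι : Type*} [Fintype ι] {X : Type*} [MeasurableSpace X] {D : Measure X}
  [IsProbabilityMeasure D]

/-- Hoeffding's lemma for one example. -/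
lemma lintegral_exp_le_of_mem_Icc {Y : X → ℝ} (hY : Measurable Y) {a B : ℝ} (hB : 0 ≤ B)
    (hab : ∀ x, Y x ∈ Set.Icc (a - B) a) (t : ℝ) :
    ∫⁻ x, ENNReal.ofReal (Real.exp (t * Y x)) ∂D ≤
      ENNReal.ofReal (Real.exp (t * (∫ x, Y x ∂D) + t ^ 2 * B ^ 2 / 8)) := by
  have hsub := ProbabilityTheory.hasSubgaussianMGF_of_mem_Icc (μ := D) hY.aemeasurable
    (Filter.Eventually.of_forall hab)
  have hint := hsub.integrable_exp_mul t
  have hmgf := hsub.mgf_le t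
  have hfac : ∀ x, Real.exp (t * Y x) =
      Real.exp (t * ∫ x, Y x ∂D) * Real.exp (t * (Y x - ∫ x, Y x ∂D)) := fun x => by
    rw [← Real.exp_add]; ring_nf
  rw [← ofReal_integral_eq_lintegral_ofReal]
  · refine ENNReal.ofReal_le_ofReal ?_
    simp_rw [hfac]
    rw [integral_const_mul, Real.exp_add]
    refine mul_le_mul_of_nonneg_left (hmgf.trans (le_of_eq ?_)) (Real.exp_pos _).le
    congr 1
    simp [abs_of_nonneg hB]
    ring
  · simp_rw [hfac]
    exact hint.const_mul _
  · exact Filter.Eventually.of_forall fun x => (Real.exp_pos _).le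

/-- Exponential moments of `m (u + ∑ i, ξ (xᵢ))`: replacing one example changes the value by at
most `B`, so that Hoeffding's lemma applies to the examples one at a time. -/
lemma lintegral_exp_sum_le {m : (ι → ℝ) → ℝ} (hm : IsMaxLike m) {ξ : X → ι → ℝ}
    (hξ : Measurable ξ) {c : ι → ℝ} {B : ℝ} (hB : 0 ≤ B)
    (hc : ∀ x i, ξ x i ∈ Set.Icc (c i - B) (c i)) (t : ℝ) (n : ℕ) (u : ι → ℝ) :
    ∫⁻ x : Fin n → X, ENNReal.ofReal (Real.exp (t * m (u + ∑ i, ξ (x i))))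
        ∂(Measure.pi fun _ => D) ≤
      ENNReal.ofReal (Real.exp (t * iterAverage D ξ m n u + n * (t ^ 2 * B ^ 2 / 8))) := by
  have hA : ∀ x i, |ξ x i| ≤ ‖c‖ + B := fun x i => by
    have h1 := norm_le_pi_norm c i
    rw [Real.norm_eq_abs, abs_le] at h1
    rw [abs_le]
    constructor <;> linarith [(hc x i).1, (hc x i).2]
  induction n generalizing u with
  | zero => simp [iterAverage]
  | succ n ih =>
    have hmn := hm.iterAverage (D := D) hξ hA n
    have hmeas : Measurable fun p : X × (Fin n → X) =>
        ENNReal.ofReal (Real.exp (t * m (u + (ξ p.1 + ∑ i, ξ (p.2 i))))) := by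
      have := hm.lipschitz.continuous.measurable
      fun_prop
    have hpeel := ((measurePreserving_piFinSuccAbove (fun _ : Fin (n + 1) => D) 0).symm
      ).lintegral_comp_emb (MeasurableEquiv.measurableEmbedding _)
      (fun x : Fin (n + 1) → X => ENNReal.ofReal (Real.exp (t * m (u + ∑ i, ξ (x i)))))
    rw [← hpeel]
    simp only [MeasurableEquiv.piFinSuccAbove_symm_apply, Fin.insertNthEquiv_apply,
      Fin.insertNth_zero, Fin.sum_univ_succ, Fin.cons_zero, Fin.cons_succ, cast_eq]
    rw [lintegral_prod _ hmeas.aemeasurable]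
    calc ∫⁻ x, ∫⁻ y : Fin n → X, ENNReal.ofReal
          (Real.exp (t * m (u + (ξ x + ∑ i, ξ (y i))))) ∂(Measure.pi fun _ => D) ∂D
        ≤ ∫⁻ x, ENNReal.ofReal (Real.exp (n * (t ^ 2 * B ^ 2 / 8))) * ENNReal.ofReal
          (Real.exp (t * iterAverage D ξ m n (u + ξ x))) ∂D := by
          refine lintegral_mono fun x => ?_
          refine le_trans (le_of_eq ?_) ((ih (u + ξ x)).trans (le_of_eq ?_))
          · simp only [add_assoc]
          · rw [← ENNReal.ofReal_mul (Real.exp_pos _).le, ← Real.exp_add]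
            ring_nf
      _ ≤ _ := by
          have hmeas2 : Measurable fun x => iterAverage D ξ m n (u + ξ x) :=
            hmn.lipschitz.continuous.measurable.comp (hξ.const_add u)
          rw [lintegral_const_mul _ (by fun_prop)]
          refine (mul_le_mul_right (lintegral_exp_le_of_mem_Icc (D := D)
            (Y := fun x => iterAverage D ξ m n (u + ξ x))
            hmeas2 (a := iterAverage D ξ m n (u + c)) hB (fun x => ⟨?_, ?_⟩) t) _).trans
            (le_of_eq ?_)
          · rw [sub_eq_add_neg, ← hmn.add_const]
            refine hmn.mono fun i => ?_
            have := (hc x i).1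
            simp only [Pi.add_apply]
            linarith
          · exact hmn.mono fun i => by simpa using (hc x i).2
          · rw [← ENNReal.ofReal_mul (Real.exp_pos _).le, ← Real.exp_add]
            simp only [iterAverage]
            push_cast
            ring_nf

variable {E : Type*} [NormedAddCommGroup E] [InnerProductSpace ℝ E]

lemma half_sqrt_add_sqrt_le {a b : ℝ} (ha : 0 ≤ a) (hb : 0 ≤ b) :
    (√a + √b) / 2 ≤ √((a + b) / 2) := by
  refine Real.le_sqrt_of_sq_le ?_
  nlinarith [sq_nonneg (√a - √b), Real.sq_sqrt ha, Real.sq_sqrt hb]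

/-- The expected maximal deviation over vectors `vᵢ` in the ball of radius `W`, with a linear shift
`⟪vᵢ, w⟫` that carries the induction: by the parallelogram law, an additional example increases the
square of the bound by at most `4 W² κ²`. -/
lemma iterAverage_maxFun_inner_le [Nonempty ι] {W κ : ℝ} (v : ι → E) (hv : ∀ i, ‖v i‖ ≤ W)
    {φ : X → E} (hφ : ∀ e : E, Measurable fun x => inner ℝ e (φ x)) (hκ : ∀ x, ‖φ x‖ ≤ κ)
    {ψ : ℝ → ℝ} (hψ : LipschitzWith 1 ψ) (hψ0 : ψ 0 = 0) (n : ℕ) (w : E) :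
    iterAverage D (fun x i => (∫ z, ψ (inner ℝ (v i) (φ z)) ∂D) - ψ (inner ℝ (v i) (φ x)))
      maxFun n (fun i => inner ℝ (v i) w) ≤ W * √(‖w‖ ^ 2 + 4 * n * κ ^ 2) := by
  set ξ : X → ι → ℝ := fun x i =>
    (∫ z, ψ (inner ℝ (v i) (φ z)) ∂D) - ψ (inner ℝ (v i) (φ x)) with hξdef
  have hW : 0 ≤ W := (norm_nonneg _).trans (hv (Classical.arbitrary ι))
  have hG : Measurable fun (x : X) (i : ι) => inner ℝ (v i) (φ x) :=
    measurable_pi_lambda _ fun i => hφ (v i)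
  have hGA : ∀ (x : X) (i : ι), |inner ℝ (v i) (φ x)| ≤ W * κ := fun x i =>
    (abs_real_inner_le_norm _ _).trans (mul_le_mul (hv i) (hκ x) (norm_nonneg _) hW)
  have hψabs : ∀ t, |ψ t| ≤ |t| := fun t => by
    simpa [hψ0, Real.dist_eq] using hψ.dist_le_mul t 0
  have hξm : Measurable ξ := measurable_pi_lambda _ fun i =>
    (hψ.continuous.measurable.comp (hφ (v i))).const_sub _
  have hξA : ∀ x i, |ξ x i| ≤ W * κ + W * κ := fun x i => by
    have h1 := norm_integral_le_of_norm_le_const (μ := D) (f := fun z => ψ (inner ℝ (v i) (φ z)))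
      (Filter.Eventually.of_forall fun x => (hψabs _).trans (hGA x i))
    have h2 := (hψabs _).trans (hGA x i)
    simp only [probReal_univ, mul_one, Real.norm_eq_abs] at h1
    exact (abs_sub _ _).trans (add_le_add h1 h2)
  induction n generalizing w with
  | zero =>
    simp only [iterAverage, Nat.cast_zero, mul_zero, zero_mul, add_zero,
      Real.sqrt_sq (norm_nonneg w)]
    exact maxFun_le fun i => (real_inner_le_norm _ _).trans
      (mul_le_mul_of_nonneg_right (hv i) (norm_nonneg w))
  | succ n ih =>
    have hm : IsMaxLike (iterAverage D ξ maxFun n) := isMaxLike_maxFun.iterAverage hξm hξA n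
    have h := hm.integral_mean_sub_le (D := D) hG hGA hψ hψ0 (fun i => inner ℝ (v i) w)
    have hpt : ∀ x, (iterAverage D ξ maxFun n
          ((fun i => inner ℝ (v i) w) + (2 : ℝ) • fun i => inner ℝ (v i) (φ x)) +
        iterAverage D ξ maxFun n
          ((fun i => inner ℝ (v i) w) - (2 : ℝ) • fun i => inner ℝ (v i) (φ x))) / 2
        ≤ W * √(‖w‖ ^ 2 + 4 * (n + 1 : ℕ) * κ ^ 2) := by
      intro x
      rw [show ((fun i => inner ℝ (v i) w) + (2 : ℝ) • fun i => inner ℝ (v i) (φ x))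
          = fun i => inner ℝ (v i) (w + (2 : ℝ) • φ x) by
            ext i; simp [inner_add_right, inner_smul_right],
        show ((fun i => inner ℝ (v i) w) - (2 : ℝ) • fun i => inner ℝ (v i) (φ x))
          = fun i => inner ℝ (v i) (w - (2 : ℝ) • φ x) by
            ext i; simp [inner_sub_right, inner_smul_right]]
      have hpar : (‖w + (2 : ℝ) • φ x‖ ^ 2 + 4 * n * κ ^ 2 +
          (‖w - (2 : ℝ) • φ x‖ ^ 2 + 4 * n * κ ^ 2)) / 2 ≤
          ‖w‖ ^ 2 + 4 * (n + 1 : ℕ) * κ ^ 2 := by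
        have h1 := parallelogram_law_with_norm ℝ w ((2 : ℝ) • φ x)
        have h2 : ‖(2 : ℝ) • φ x‖ = 2 * ‖φ x‖ := by rw [norm_smul]; simp
        have h3 : ‖φ x‖ ^ 2 ≤ κ ^ 2 := pow_le_pow_left₀ (norm_nonneg _) (hκ x) 2
        rw [h2] at h1
        push_cast
        nlinarith
      calc _ ≤ (W * √(‖w + (2 : ℝ) • φ x‖ ^ 2 + 4 * n * κ ^ 2) +
            W * √(‖w - (2 : ℝ) • φ x‖ ^ 2 + 4 * n * κ ^ 2)) / 2 := by
            gcongr
            · exact ih _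
            · exact ih _
        _ = W * ((√(‖w + (2 : ℝ) • φ x‖ ^ 2 + 4 * n * κ ^ 2) +
            √(‖w - (2 : ℝ) • φ x‖ ^ 2 + 4 * n * κ ^ 2)) / 2) := by ring
        _ ≤ W * √(‖w‖ ^ 2 + 4 * (n + 1 : ℕ) * κ ^ 2) := by
            refine mul_le_mul_of_nonneg_left ?_ hW
            exact (half_sqrt_add_sqrt_le (by positivity) (by positivity)).trans
              (Real.sqrt_le_sqrt hpar)
    have hG2 : ∀ (x : X) (i : ι), |((2 : ℝ) • fun i => inner ℝ (v i) (φ x)) i| ≤ 2 * (W * κ) :=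
      fun x i => by simpa [abs_mul] using hGA x i
    have I1 := hm.integrable_comp (D := D) (hG.const_smul (2 : ℝ)) hG2 fun i => inner ℝ (v i) w
    have I2 := hm.integrable_comp (D := D) (hG.const_smul (2 : ℝ)).neg
      (A := 2 * (W * κ))
      (fun x i => by rw [Pi.neg_apply, Pi.neg_apply, abs_neg]; exact hG2 x i) fun i => inner ℝ (v i) w
    refine le_trans h (le_of_le_of_eq
      (integral_mono ((I1.add ?_).div_const 2) (integrable_const _) hpt) (by simp))
    simpa only [Pi.neg_apply, Pi.smul_apply, ← sub_eq_add_neg] using I2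

/-- McDiarmid's bound for finitely many vectors in the ball of radius `W`. -/
lemma measure_exists_deviation_le [Nonempty ι] {W κ : ℝ} (v : ι → E) (hv : ∀ i, ‖v i‖ ≤ W)
    {φ : X → E} (hφ : ∀ e : E, Measurable fun x => inner ℝ e (φ x)) (hκ : ∀ x, ‖φ x‖ ≤ κ)
    {ψ : ℝ → ℝ} (hψ : LipschitzWith 1 ψ) (hψ0 : ψ 0 = 0) {B : ℝ} (hB : 0 < B)
    (hψB : ∀ t, ψ t ∈ Set.Icc 0 B) {ε : ℝ} (hε : 0 < ε) (n : ℕ)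
    (hn : 2 * W * κ * √n ≤ n * ε / 4) :
    (Measure.pi fun _ : Fin n => D) {x | ∃ i, n * ε / 2 ≤
        ∑ j, ((∫ z, ψ (inner ℝ (v i) (φ z)) ∂D) - ψ (inner ℝ (v i) (φ (x j))))} ≤
      ENNReal.ofReal (Real.exp (-(n * ε ^ 2 / (8 * B ^ 2)))) := by
  set c : ι → ℝ := fun i => ∫ z, ψ (inner ℝ (v i) (φ z)) ∂D with hc
  set ξ : X → ι → ℝ := fun x i => c i - ψ (inner ℝ (v i) (φ x)) with hξdef
  have hκ0 : 0 ≤ κ := by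
    obtain ⟨x⟩ : Nonempty X := by
      by_contra h
      rw [not_nonempty_iff] at h
      exact (IsProbabilityMeasure.ne_zero D) (Measure.eq_zero_of_isEmpty D)
    exact (norm_nonneg _).trans (hκ x)
  have hξm : Measurable ξ := measurable_pi_lambda _ fun i =>
    (hψ.continuous.measurable.comp (hφ (v i))).const_sub _
  have hmom := lintegral_exp_sum_le (D := D) (isMaxLike_maxFun (ι := ι)) hξm (c := c) hB.le
    (fun x i => ⟨by linarith [(hψB (inner ℝ (v i) (φ x))).2],
      by linarith [(hψB (inner ℝ (v i) (φ x))).1]⟩) (ε / B ^ 2) n 0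
  have hmean : iterAverage D ξ maxFun n 0 ≤ n * ε / 4 := by
    have h := iterAverage_maxFun_inner_le (D := D) v hv hφ hκ hψ hψ0 n 0
    simp only [inner_zero_right] at h
    refine le_trans h (le_trans (le_of_eq ?_) hn)
    rw [norm_zero, show (0 : ℝ) ^ 2 + 4 * n * κ ^ 2 = (2 * κ) ^ 2 * n by ring,
      Real.sqrt_mul (by positivity), Real.sqrt_sq (by positivity)]
    ring
  have hmeas : Measurable fun x : Fin n → X =>
      ENNReal.ofReal (Real.exp (ε / B ^ 2 * maxFun (0 + ∑ i, ξ (x i)))) := by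
    have := (isMaxLike_maxFun (ι := ι)).lipschitz.continuous.measurable
    fun_prop
  have ht : 0 < ε / B ^ 2 := by positivity
  -- Markov's inequality for the exponential moment with the optimal parameter `ε / B²`
  set r := ENNReal.ofReal (Real.exp (ε / B ^ 2 * (n * ε / 2))) with hr
  have hr0 : r ≠ 0 := by simp [hr, Real.exp_pos]
  have hsub : {x : Fin n → X | ∃ i, n * ε / 2 ≤ ∑ j, (c i - ψ (inner ℝ (v i) (φ (x j))))} ⊆
      {x | r ≤ ENNReal.ofReal (Real.exp (ε / B ^ 2 * maxFun (0 + ∑ i, ξ (x i))))} := by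
    rintro x ⟨i, hi⟩
    refine ENNReal.ofReal_le_ofReal (Real.exp_le_exp.2 (mul_le_mul_of_nonneg_left ?_ ht.le))
    refine hi.trans (le_trans (le_of_eq ?_) (le_maxFun _ i))
    simp [hξdef]
  refine (measure_mono hsub).trans ((ENNReal.le_div_iff_mul_le (Or.inl hr0)
    (Or.inl ENNReal.ofReal_ne_top)).2 ((mul_comm _ _).trans_le
      (mul_meas_ge_le_lintegral hmeas r)) |>.trans ?_)
  rw [ENNReal.div_le_iff hr0 ENNReal.ofReal_ne_top, hr, ← ENNReal.ofReal_mul (Real.exp_pos _).le,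
    ← Real.exp_add]
  refine hmom.trans (ENNReal.ofReal_le_ofReal (Real.exp_le_exp.2 ?_))
  have h1 := mul_le_mul_of_nonneg_left hmean ht.le
  have h2 : (ε / B ^ 2) ^ 2 * B ^ 2 = ε ^ 2 / B ^ 2 := by field_simp
  have h3 : -(n * ε ^ 2 / (8 * B ^ 2)) + ε / B ^ 2 * (n * ε / 2)
      = ε / B ^ 2 * (n * ε / 4) + n * (ε ^ 2 / B ^ 2 / 8) := by
    field_simp
    ring
  rw [h2, h3]
  linarith

/-- With high probability, every vector in the ball of radius `W` (more precisely: in a separable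
subset) that is orthogonal to all examples has a small expected loss. -/
theorem measure_exists_orthogonal_le {W κ : ℝ} {S : Set E} (hS : TopologicalSpace.IsSeparable S)
    (hSW : ∀ v ∈ S, ‖v‖ ≤ W)
    {φ : X → E} (hφ : ∀ e : E, Measurable fun x => inner ℝ e (φ x)) (hκ : ∀ x, ‖φ x‖ ≤ κ)
    {ψ : ℝ → ℝ} (hψ : LipschitzWith 1 ψ) (hψ0 : ψ 0 = 0) {B : ℝ} (hB : 0 < B)
    (hψB : ∀ t, ψ t ∈ Set.Icc 0 B) {ε : ℝ} (hε : 0 < ε) (n : ℕ)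
    (hn : 2 * W * κ * √n ≤ n * ε / 4) :
    (Measure.pi fun _ : Fin n => D) {x | ∃ v ∈ S, (∀ j, inner ℝ v (φ (x j)) = 0) ∧
        ε ≤ ∫ z, ψ (inner ℝ v (φ z)) ∂D} ≤
      ENNReal.ofReal (Real.exp (-(n * ε ^ 2 / (8 * B ^ 2)))) := by
  rcases S.eq_empty_or_nonempty with rfl | hne
  · simp
  have hκ0 : 0 ≤ κ := by
    obtain ⟨x⟩ : Nonempty X := by
      by_contra h
      rw [not_nonempty_iff] at h
      exact (IsProbabilityMeasure.ne_zero D) (Measure.eq_zero_of_isEmpty D)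
    exact (norm_nonneg _).trans (hκ x)
  obtain ⟨T, hTS, hTc, hST⟩ := hS.exists_countable_dense_subset
  have hTne : T.Nonempty := by
    rw [← closure_nonempty_iff]
    exact hne.mono hST
  obtain ⟨e, rfl⟩ := hTc.exists_eq_range hTne
  -- exhaust a dense sequence of `S` by finite sets, with a bound that does not depend on their size
  let F : ℕ → Set (Fin n → X) := fun N => {x | ∃ i : Fin (N + 1), n * ε / 2 ≤
    ∑ j, ((∫ z, ψ (inner ℝ (e i) (φ z)) ∂D) - ψ (inner ℝ (e i) (φ (x j))))}
  have hFmono : Monotone F := fun N M hNM x ⟨i, hi⟩ =>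
    ⟨⟨i, i.2.trans_le (by omega)⟩, hi⟩
  have hψi : ∀ v : E, Integrable (fun z => ψ (inner ℝ v (φ z))) D := fun v =>
    Integrable.of_mem_Icc 0 B (hψ.continuous.measurable.comp (hφ v)).aemeasurable
      (Filter.Eventually.of_forall fun z => hψB _)
  have hsub : {x : Fin n → X | ∃ v ∈ S, (∀ j, inner ℝ v (φ (x j)) = 0) ∧
      ε ≤ ∫ z, ψ (inner ℝ v (φ z)) ∂D} ⊆ ⋃ N, F N := by
    rintro x ⟨v, hvS, hv0, hvε⟩
    -- an approximation of `v` loses at most `ε / 4` in the mean and `ε / 4` on each example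
    obtain ⟨w, ⟨N, rfl⟩, hN⟩ := Metric.mem_closure_iff.1 (hST hvS) (ε / (4 * (κ + 1)))
      (by positivity)
    have hdist : ∀ z, |inner ℝ v (φ z) - inner ℝ (e N) (φ z)| ≤ ε / 4 := fun z => by
      rw [← inner_sub_left]
      refine (abs_real_inner_le_norm _ _).trans ?_
      rw [dist_eq_norm] at hN
      calc ‖v - e N‖ * ‖φ z‖ ≤ ε / (4 * (κ + 1)) * (κ + 1) := by
            gcongr
            linarith [hκ z]
        _ = ε / 4 := by field_simp
    have hψd : ∀ z, |ψ (inner ℝ v (φ z)) - ψ (inner ℝ (e N) (φ z))| ≤ ε / 4 := fun z => by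
      have := hψ.dist_le_mul (inner ℝ v (φ z)) (inner ℝ (e N) (φ z))
      simp only [Real.dist_eq, NNReal.coe_one, one_mul] at this
      exact this.trans (hdist z)
    have h1 : ε - ε / 4 ≤ ∫ z, ψ (inner ℝ (e N) (φ z)) ∂D := by
      have : ∫ z, ψ (inner ℝ v (φ z)) ∂D ≤ ∫ z, (ψ (inner ℝ (e N) (φ z)) + ε / 4) ∂D :=
        integral_mono (hψi v) ((hψi _).add (integrable_const _)) fun z => by
          linarith [(abs_le.1 (hψd z)).2]
      rw [integral_add (hψi _) (integrable_const _)] at this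
      simp only [integral_const, probReal_univ, one_smul] at this
      linarith
    have h2 : ∀ j, ψ (inner ℝ (e N) (φ (x j))) ≤ ε / 4 := fun j => by
      have := (abs_le.1 (hψd (x j))).1
      rw [hv0 j, hψ0] at this
      linarith
    refine Set.mem_iUnion.2 ⟨N, ⟨⟨N, by omega⟩, ?_⟩⟩
    calc (n : ℝ) * ε / 2 = ∑ _j : Fin n, ε / 2 := by simp; ring
      _ ≤ _ := Finset.sum_le_sum fun j _ => by simp only; linarith [h2 j]
  refine (measure_mono hsub).trans ?_
  rw [hFmono.measure_iUnion]
  exact iSup_le fun N => measure_exists_deviation_le (D := D) (fun i : Fin (N + 1) => e i)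
    (fun i => hSW _ (hTS ⟨i, rfl⟩)) hφ hκ hψ hψ0 hB hψB hε n hn

end

/-! ### The feature map of a dot product kernel -/

/-- The tensor `(uₖ x^{⊗ k})ₖ`, as a family indexed by the monomials. -/
def tensorCoeff {d : ℕ} (u : ℕ → ℝ) (x : EuclideanSpace ℝ (Fin d))
    (s : Σ k : ℕ, Fin k → Fin d) : ℝ :=
  u s.1 * ∏ i, x (s.2 i)

lemma sum_tensorCoeff_mul {d : ℕ} (u w : ℕ → ℝ) (x y : EuclideanSpace ℝ (Fin d)) (k : ℕ) :
    ∑ s : Fin k → Fin d, tensorCoeff u x ⟨k, s⟩ * tensorCoeff w y ⟨k, s⟩ =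
      u k * w k * inner ℝ x y ^ k := by
  have h : inner ℝ x y = ∑ i, x i * y i := by
    rw [real_inner_comm]
    simp [PiLp.inner_apply]
  rw [h, Fintype.sum_pow, Finset.mul_sum]
  refine Finset.sum_congr rfl fun s _ => ?_
  simp only [tensorCoeff]
  rw [Finset.prod_mul_distrib]
  ring

lemma memℓp_tensorCoeff {d : ℕ} {u : ℕ → ℝ} {x : EuclideanSpace ℝ (Fin d)}
    (h : Summable fun k => u k ^ 2 * (‖x‖ ^ 2) ^ k) : Memℓp (tensorCoeff u x) 2 := by
  refine memℓp_gen ?_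
  have hs : Summable fun s => tensorCoeff u x s * tensorCoeff u x s := by
    refine (summable_sigma_of_nonneg fun s => mul_self_nonneg _).2
      ⟨fun k => Summable.of_finite, h.congr fun k => ?_⟩
    rw [tsum_fintype, sum_tensorCoeff_mul, real_inner_self_eq_norm_sq]
    ring
  refine hs.congr fun s => ?_
  rw [Real.norm_eq_abs]
  simp [pow_two]

/-- The inner product of two tensors is a power series in the inner product of the vectors. -/
lemma hasSum_inner_tensorCoeff {d : ℕ} {u w : ℕ → ℝ} {x y : EuclideanSpace ℝ (Fin d)}
    (hx : Memℓp (tensorCoeff u x) 2) (hy : Memℓp (tensorCoeff w y) 2) :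
    HasSum (fun k => u k * w k * inner ℝ x y ^ k)
      (inner ℝ (⟨_, hx⟩ : lp (fun _ : Σ k : ℕ, Fin k → Fin d => ℝ) 2) ⟨_, hy⟩) := by
  refine (lp.hasSum_inner (𝕜 := ℝ) (⟨_, hx⟩ : lp (fun _ : Σ k : ℕ, Fin k → Fin d => ℝ) 2)
    ⟨_, hy⟩).sigma fun k => ?_
  rw [← sum_tensorCoeff_mul]
  refine (hasSum_fintype fun s : Fin k → Fin d =>
    tensorCoeff u x ⟨k, s⟩ * tensorCoeff w y ⟨k, s⟩).congr_fun fun s => ?_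
  rw [real_inner_comm]
  rfl

lemma tsum_sq_le_sq_tsum {t : ℕ → ℝ} (ht0 : ∀ k, 0 ≤ t k) (ht : Summable t) :
    (Summable fun k => t k ^ 2) ∧ ∑' k, t k ^ 2 ≤ (∑' k, t k) ^ 2 := by
  have hle : ∀ k, t k ^ 2 ≤ (∑' j, t j) * t k := fun k => by
    rw [pow_two]
    exact mul_le_mul_of_nonneg_right (ht.le_tsum k fun j _ => ht0 j) (ht0 k)
  have hs : Summable fun k => t k ^ 2 :=
    Summable.of_nonneg_of_le (fun k => sq_nonneg _) hle (ht.mul_left _)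
  refine ⟨hs, (hs.tsum_le_tsum hle (ht.mul_left _)).trans (le_of_eq ?_)⟩
  rw [tsum_mul_left, pow_two]

lemma norm_coe_unitSphere {d : ℕ} (x : UnitSphere d) : ‖(x : EuclideanSpace ℝ (Fin d))‖ = 1 := by
  simp

lemma abs_inner_unitSphere_le {d : ℕ} (x y : UnitSphere d) :
    |inner ℝ (x : EuclideanSpace ℝ (Fin d)) (y : EuclideanSpace ℝ (Fin d))| ≤ 1 := by
  simpa using abs_real_inner_le_norm (x : EuclideanSpace ℝ (Fin d)) (y : EuclideanSpace ℝ (Fin d))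

lemma SlowlyDecaying.pos {b : ℕ → ℝ} (hb : SlowlyDecaying b) (k : ℕ) : 0 < b k := by
  obtain ⟨c, hc, h⟩ := hb.lower
  exact lt_of_lt_of_le (by positivity) (h k)

/-- The function `x ↦ g (β ⬝ x)` is represented by a vector `a` of the feature space of the kernel,
with `‖a‖² ≤ 4 M / c`. The features of `x` are the tensors `√bₖ x^{⊗ k}`, and `a` consists of the
tensors `aₖ / √bₖ β^{⊗ k}`. -/
theorem exists_featureMap {b : ℕ → ℝ} (hb : SlowlyDecaying b) {c : ℝ} (hc : 0 < c)
    (hbc : ∀ k : ℕ, c / ((k : ℝ) + 1) ^ 2 ≤ b k) {g : ℝ → ℝ}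
    {p : FormalMultilinearSeries ℝ ℝ ℝ} {R : ℝ≥0∞} (hg : HasFPowerSeriesOnBall g p 0 R) {d : ℕ}
    {β : EuclideanSpace ℝ (Fin d)} (hβ : ‖β‖ₑ < R) :
    ∃ (φ : UnitSphere d → lp (fun _ : Σ k : ℕ, Fin k → Fin d => ℝ) 2)
      (a : lp (fun _ : Σ k : ℕ, Fin k → Fin d => ℝ) 2),
      (∀ x y, inner ℝ (φ x) (φ y) = dotKernel b x y) ∧
      (∀ x, inner ℝ a (φ x) = g (inner ℝ β x.1)) ∧ ‖a‖ ^ 2 ≤ 4 / c * sqrtM p ‖β‖ ^ 2 := by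
  have hbpos := hb.pos
  have hβ' : ENNReal.ofReal ‖β‖ < R := by rwa [ofReal_norm]
  obtain ⟨hts, htle⟩ := tsum_succ_mul_abs_coeff_le_sqrtM hg (norm_nonneg β) hβ'
  set t : ℕ → ℝ := fun k => ((k : ℝ) + 1) * |p.coeff k| * ‖β‖ ^ k with htdef
  have ht0 : ∀ k, 0 ≤ t k := fun k => by positivity
  obtain ⟨ht2s, ht2le⟩ := tsum_sq_le_sq_tsum ht0 hts
  have hφ : ∀ x : UnitSphere d,
      Memℓp (tensorCoeff (fun k => √(b k)) (x : EuclideanSpace ℝ (Fin d))) 2 := fun x =>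
    memℓp_tensorCoeff (hb.summable.congr fun k => by
      rw [norm_coe_unitSphere, Real.sq_sqrt (hbpos k).le]; simp)
  have hterm : ∀ k, (p.coeff k / √(b k)) ^ 2 * (‖β‖ ^ 2) ^ k ≤ 1 / c * t k ^ 2 := fun k => by
    rw [div_pow, Real.sq_sqrt (hbpos k).le]
    have h1 : 1 / b k ≤ 1 / c * ((k : ℝ) + 1) ^ 2 := by
      have := one_div_le_one_div_of_le (by positivity) (hbc k)
      refine this.trans (le_of_eq ?_)
      field_simp
    calc p.coeff k ^ 2 / b k * (‖β‖ ^ 2) ^ k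
        = 1 / b k * (|p.coeff k| ^ 2 * (‖β‖ ^ k) ^ 2) := by
          rw [sq_abs, ← pow_mul, ← pow_mul, mul_comm 2 k]; ring
      _ ≤ 1 / c * ((k : ℝ) + 1) ^ 2 * (|p.coeff k| ^ 2 * (‖β‖ ^ k) ^ 2) := by gcongr
      _ = 1 / c * t k ^ 2 := by rw [htdef]; ring
  have has : Summable fun k => (p.coeff k / √(b k)) ^ 2 * (‖β‖ ^ 2) ^ k :=
    Summable.of_nonneg_of_le (fun k => by positivity) hterm (ht2s.mul_left _)
  have ha : Memℓp (tensorCoeff (fun k => p.coeff k / √(b k)) β) 2 := memℓp_tensorCoeff has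
  refine ⟨fun x => ⟨_, hφ x⟩, ⟨_, ha⟩, fun x y => ?_, fun x => ?_, ?_⟩
  · rw [← (hasSum_inner_tensorCoeff (hφ x) (hφ y)).tsum_eq, dotKernel, kernelProfile]
    exact tsum_congr fun k => by rw [Real.mul_self_sqrt (hbpos k).le]
  · have hin : ‖inner ℝ β (x : EuclideanSpace ℝ (Fin d))‖ₑ < R := by
      refine lt_of_le_of_lt ?_ hβ
      rw [enorm_le_iff_norm_le]
      simpa using abs_real_inner_le_norm β (x : EuclideanSpace ℝ (Fin d))
    have h := hg.hasSum (y := inner ℝ β (x : EuclideanSpace ℝ (Fin d))) (by simpa using hin)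
    rw [zero_add] at h
    refine (hasSum_inner_tensorCoeff ha (hφ x)).unique (h.congr_fun fun k => ?_)
    rw [div_mul_cancel₀ _ (Real.sqrt_ne_zero'.2 (hbpos k)),
      FormalMultilinearSeries.apply_eq_pow_smul_coeff, smul_eq_mul, mul_comm]
  · rw [← real_inner_self_eq_norm_sq, ← (hasSum_inner_tensorCoeff ha ha).tsum_eq,
      real_inner_self_eq_norm_sq]
    have hts0 : 0 ≤ ∑' k, t k := tsum_nonneg ht0
    calc ∑' k, p.coeff k / √(b k) * (p.coeff k / √(b k)) * (‖β‖ ^ 2) ^ k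
        = ∑' k, (p.coeff k / √(b k)) ^ 2 * (‖β‖ ^ 2) ^ k := tsum_congr fun k => by ring
      _ ≤ ∑' k, 1 / c * t k ^ 2 := has.tsum_le_tsum hterm (ht2s.mul_left _)
      _ = 1 / c * ∑' k, t k ^ 2 := tsum_mul_left
      _ ≤ 1 / c * (2 * sqrtM p ‖β‖) ^ 2 := by
          refine mul_le_mul_of_nonneg_left (ht2le.trans ?_) (by positivity)
          exact pow_le_pow_left₀ hts0 htle 2
      _ = 4 / c * sqrtM p ‖β‖ ^ 2 := by ring

lemma continuous_dotKernel {b : ℕ → ℝ} (hb : SlowlyDecaying b) (d : ℕ) :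
    Continuous fun q : UnitSphere d × UnitSphere d => dotKernel b q.1 q.2 := by
  have hin : Continuous fun q : UnitSphere d × UnitSphere d =>
      inner ℝ (q.1 : EuclideanSpace ℝ (Fin d)) (q.2 : EuclideanSpace ℝ (Fin d)) := by fun_prop
  refine continuous_tsum (u := b) (fun k => by fun_prop) hb.summable fun k q => ?_
  rw [norm_mul, norm_pow, Real.norm_of_nonneg (hb.pos k).le, Real.norm_eq_abs]
  exact mul_le_of_le_one_right (hb.pos k).le
    (pow_le_one₀ (abs_nonneg _) (abs_inner_unitSphere_le _ _))

lemma dotKernel_self {b : ℕ → ℝ} {d : ℕ} (x : UnitSphere d) : dotKernel b x x = ∑' k, b k := by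
  rw [dotKernel, kernelProfile, real_inner_self_eq_norm_sq, norm_coe_unitSphere]
  simp

section

variable {E : Type*} [NormedAddCommGroup E] [InnerProductSpace ℝ E]

lemma continuous_featureMap {b : ℕ → ℝ} (hb : SlowlyDecaying b) {d : ℕ} {φ : UnitSphere d → E}
    (hφ : ∀ x y, inner ℝ (φ x) (φ y) = dotKernel b x y) : Continuous φ := by
  rw [continuous_iff_continuousAt]
  intro x
  rw [ContinuousAt, tendsto_iff_norm_sub_tendsto_zero]
  have h : ∀ y, ‖φ y - φ x‖ = √(dotKernel b y y - 2 * dotKernel b y x + dotKernel b x x) := by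
    intro y
    rw [← hφ, ← hφ, ← hφ, real_inner_self_eq_norm_sq, real_inner_self_eq_norm_sq,
      ← norm_sub_sq_real, Real.sqrt_sq (norm_nonneg _)]
  simp_rw [h]
  have hK := continuous_dotKernel hb d
  have hcont : Continuous fun y =>
      √(dotKernel b y y - 2 * dotKernel b y x + dotKernel b x x) := by
    have h1 : Continuous fun y : UnitSphere d => dotKernel b y y :=
      hK.comp (continuous_id.prodMk continuous_id)
    have h2 : Continuous fun y : UnitSphere d => dotKernel b y x :=
      hK.comp (continuous_id.prodMk continuous_const)
    fun_prop
  have := hcont.tendsto x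
  rwa [show dotKernel b x x - 2 * dotKernel b x x + dotKernel b x x = 0 by ring,
    Real.sqrt_zero] at this

lemma norm_featureMap {b : ℕ → ℝ} {d : ℕ} {φ : UnitSphere d → E}
    (hφ : ∀ x y, inner ℝ (φ x) (φ y) = dotKernel b x y) (x : UnitSphere d) :
    ‖φ x‖ = √(∑' k, b k) := by
  rw [← dotKernel_self x, ← hφ, real_inner_self_eq_norm_sq, Real.sqrt_sq (norm_nonneg _)]

end

/-! ### Kernel learning -/

section

variable {E : Type*} [NormedAddCommGroup E] [InnerProductSpace ℝ E]

lemma exists_isInterpolating {b : ℕ → ℝ} {d n : ℕ} {φ : UnitSphere d → E}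
    (hφ : ∀ x y, inner ℝ (φ x) (φ y) = dotKernel b x y) {f : UnitSphere d → ℝ} {a : E}
    (ha : ∀ x, inner ℝ a (φ x) = f x) (x : Fin n → UnitSphere d) :
    ∃ α, IsInterpolating b x (fun i => f (x i)) α := by
  let U := Submodule.span ℝ (Set.range fun j => φ (x j))
  have : FiniteDimensional ℝ U := FiniteDimensional.span_of_finite ℝ (Set.finite_range _)
  obtain ⟨α, hα⟩ := (Submodule.mem_span_range_iff_exists_fun ℝ).1
    (U.starProjection_apply_mem a)
  refine ⟨α, fun i => ?_⟩
  have hmem : φ (x i) ∈ U := Submodule.subset_span ⟨i, rfl⟩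
  have h := U.starProjection_inner_eq_zero a (φ (x i)) hmem
  rw [inner_sub_left, ← hα, sum_inner, ha] at h
  simp_rw [inner_smul_left, hφ] at h
  simpa using (sub_eq_zero.1 h).symm

/-- The vectors of the form `a - ∑ j, αⱼ φ (xⱼ)` with `n` features. Unlike the feature space itself,
this set is separable whenever `φ` is continuous on a separable space. -/
def residualSet (n : ℕ) {X : Type*} (φ : X → E) (a : E) : Set E :=
  Set.range fun q : (Fin n → ℝ) × (Fin n → X) => a - ∑ j, q.1 j • φ (q.2 j)

/-- The error of the interpolant is represented by a vector that is orthogonal to the features of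
the examples and no longer than `a`: the interpolant is the orthogonal projection of `a` to their
span. -/
lemma exists_residual {b : ℕ → ℝ} {d n : ℕ} {φ : UnitSphere d → E}
    (hφ : ∀ x y, inner ℝ (φ x) (φ y) = dotKernel b x y) {f : UnitSphere d → ℝ} {a : E}
    (ha : ∀ x, inner ℝ a (φ x) = f x) (x : Fin n → UnitSphere d) :
    ∃ v ∈ residualSet n φ a, ‖v‖ ≤ ‖a‖ ∧ (∀ j, inner ℝ v (φ (x j)) = 0) ∧
      ∀ z, f z - kernelModel b x (fun i => f (x i)) z = inner ℝ v (φ z) := by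
  have hex := exists_isInterpolating hφ ha x
  have hspec : IsInterpolating b x (fun i => f (x i)) hex.choose := hex.choose_spec
  set α := hex.choose with hα
  have hw : ∀ z, inner ℝ (∑ j, α j • φ (x j)) (φ z) = ∑ j, α j * dotKernel b (x j) z := by
    intro z
    rw [sum_inner]
    exact Finset.sum_congr rfl fun j _ => by rw [real_inner_smul_left, hφ]
  set w := ∑ j, α j • φ (x j) with hwdef
  have horth : ∀ j, inner ℝ (a - w) (φ (x j)) = 0 := fun j => by
    rw [inner_sub_left, hw, ha, hspec j, sub_self]
  refine ⟨a - w, ⟨(α, x), rfl⟩, ?_, horth, fun z => ?_⟩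
  · have h0 : inner ℝ (a - w) w = 0 := by
      conv_lhs => rw [hwdef, inner_sum]
      refine Finset.sum_eq_zero fun j _ => ?_
      rw [real_inner_smul_right, horth, mul_zero]
    have h1 := norm_add_sq_eq_norm_sq_add_norm_sq_of_inner_eq_zero (a - w) w h0
    rw [sub_add_cancel] at h1
    nlinarith [norm_nonneg a, norm_nonneg (a - w), norm_nonneg w]
  · rw [inner_sub_left, ha, hw, kernelModel, dif_pos hex]

lemma isSeparable_residualSet (n : ℕ) {X : Type*} [TopologicalSpace X]
    [TopologicalSpace.SeparableSpace X] {φ : X → E} (hφ : Continuous φ) (a : E) :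
    TopologicalSpace.IsSeparable (residualSet n φ a) :=
  TopologicalSpace.isSeparable_range (by fun_prop)

lemma IsLoss.le_abs_sub {L : ℝ → ℝ → ℝ} (hL : IsLoss L) (y z : ℝ) : L y z ≤ |y - z| := by
  have h := (hL.lipschitz y).dist_le_mul z y
  rw [hL.self, Real.dist_eq, Real.dist_eq, sub_zero, abs_sub_comm z y] at h
  exact (le_abs_self _).trans (by simpa using h)

/-- Sufficient numbers of examples for kernel learning. If `‖a‖ κ < ε`, where `κ² = ∑ bₖ`, the model
is accurate for every sample. -/
theorem kernelLearns_of_le {b : ℕ → ℝ} (hb : SlowlyDecaying b) {d : ℕ} {φ : UnitSphere d → E}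
    (hφ : ∀ x y, inner ℝ (φ x) (φ y) = dotKernel b x y) {f : UnitSphere d → ℝ} {a : E}
    (ha : ∀ x, inner ℝ a (φ x) = f x) {L : ℝ → ℝ → ℝ} (hL : IsLoss L)
    (D : Measure (UnitSphere d)) [IsProbabilityMeasure D] {ε δ B : ℝ} (hε : 0 < ε) (hδ : 0 < δ)
    {n : ℕ} (hB : 0 < B) (hLB : (∀ y z, L y z ≤ B) ∨ ‖a‖ * √(∑' k, b k) ≤ B)
    (hn : ε ≤ ‖a‖ * √(∑' k, b k) →
      (8 * (‖a‖ * √(∑' k, b k))) ^ 2 ≤ n * ε ^ 2 ∧ Real.log δ⁻¹ * (8 * B ^ 2) < n * ε ^ 2) :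
    KernelLearns b L f D ε δ n := by
  set κ := √(∑' k, b k) with hκ
  have hκφ : ∀ x, ‖φ x‖ = κ := norm_featureMap hφ
  have hφc : Continuous φ := continuous_featureMap hb hφ
  -- the truncated absolute error dominates the loss, in both cases of `hLB`
  let ψ : ℝ → ℝ := fun t => min B |t|
  have hψ : LipschitzWith 1 ψ := lipschitzWith_one_norm.const_min B
  have hψ0 : ψ 0 = 0 := by simp [ψ, hB.le]
  have hψB : ∀ t, ψ t ∈ Set.Icc 0 B := fun t => ⟨le_min hB.le (abs_nonneg t), min_le_left _ _⟩
  have hφm : ∀ e : E, Measurable fun x => inner ℝ e (φ x) := fun e =>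
    (continuous_const.inner hφc).measurable
  have hψi : ∀ v : E, Integrable (fun z => ψ (inner ℝ v (φ z))) D := fun v =>
    Integrable.of_mem_Icc 0 B (hψ.continuous.measurable.comp (hφm v)).aemeasurable
      (Filter.Eventually.of_forall fun z => hψB _)
  -- the failure event is contained in the one of the uniform convergence theorem
  have hsub : {x : Fin n → UnitSphere d | ENNReal.ofReal ε ≤
      risk L D f (kernelModel b x fun i => f (x i))} ⊆
      {x | ∃ v ∈ residualSet n φ a ∩ Metric.closedBall 0 ‖a‖,
        (∀ j, inner ℝ v (φ (x j)) = 0) ∧ ε ≤ ∫ z, ψ (inner ℝ v (φ z)) ∂D} := by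
    intro x hx
    obtain ⟨v, hvS, hva, hv0, hvz⟩ := exists_residual hφ ha x
    refine ⟨v, ⟨hvS, by simpa using hva⟩, hv0, ?_⟩
    have hle : ∀ z, L (f z) (kernelModel b x (fun i => f (x i)) z) ≤ ψ (inner ℝ v (φ z)) := by
      intro z
      have h1 := hL.le_abs_sub (f z) (kernelModel b x (fun i => f (x i)) z)
      rw [hvz] at h1
      refine le_min ?_ h1
      rcases hLB with h | h
      · exact h _ _
      · refine h1.trans ((abs_real_inner_le_norm _ _).trans (le_trans ?_ h))
        rw [hκφ]
        gcongr
    have h2 : ENNReal.ofReal ε ≤ ENNReal.ofReal (∫ z, ψ (inner ℝ v (φ z)) ∂D) := by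
      rw [ofReal_integral_eq_lintegral_ofReal (hψi v)
        (Filter.Eventually.of_forall fun z => (hψB _).1)]
      exact le_trans hx (lintegral_mono fun z => ENNReal.ofReal_le_ofReal (hle z))
    exact (ENNReal.ofReal_le_ofReal_iff (integral_nonneg fun z => (hψB _).1)).1 h2
  refine (measure_mono hsub).trans_lt ?_
  rcases lt_or_ge (‖a‖ * κ) ε with hlt | hge
  · rw [Set.eq_empty_of_forall_notMem (s := {x | _})]
    · simpa using hδ
    · rintro x ⟨v, ⟨-, hv⟩, -, hvε⟩
      refine absurd hvε (not_le.2 (lt_of_le_of_lt ?_ hlt))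
      have : ∫ z, ψ (inner ℝ v (φ z)) ∂D ≤ ∫ _, ‖a‖ * κ ∂D :=
        integral_mono (hψi v) (integrable_const _) fun z =>
          (min_le_right _ _).trans ((abs_real_inner_le_norm _ _).trans (by
            rw [hκφ]
            gcongr
            simpa using hv))
      simpa using this
  · obtain ⟨h1, h2⟩ := hn hge
    have hn4 : 2 * ‖a‖ * κ * √n ≤ n * ε / 4 := by
      have h3 : 8 * (‖a‖ * κ) ≤ √n * ε := by
        refine le_of_sq_le_sq ?_ (by positivity)
        rwa [mul_pow (√n), Real.sq_sqrt (by positivity)]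
      have h4 : √(n : ℝ) * √n = n := Real.mul_self_sqrt (by positivity)
      have h5 := mul_le_mul_of_nonneg_left h3 (Real.sqrt_nonneg (n : ℝ))
      nlinarith
    refine (measure_exists_orthogonal_le (D := D)
      ((isSeparable_residualSet n hφc a).mono Set.inter_subset_left)
      (fun v hv => by simpa using hv.2) hφm (fun x => (hκφ x).le) hψ hψ0 hB hψB hε n hn4).trans_lt ?_
    rw [ENNReal.ofReal_lt_ofReal_iff hδ, ← Real.lt_log_iff_exp_lt hδ, neg_lt, ← Real.log_inv,
      lt_div_iff₀ (by positivity)]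
    exact h2

end

lemma hasSampleBound_of_forall {X : Type*} [MeasurableSpace X]
    {learns : Measure X → ℝ → ℝ → ℕ → Prop} {bound : ℝ → ℝ → ℝ}
    (h : ∀ (D : Measure X), IsProbabilityMeasure D → ∀ ε δ : ℝ, 0 < ε → 0 < δ → δ < 1 → ∀ n : ℕ,
      bound ε δ < n + 1 → learns D ε δ n) :
    HasSampleBound learns bound := by
  intro D hD ε δ hε hδ hδ1
  have hle : sampleComplexity (learns D ε δ) ≤ (⌊bound ε δ⌋₊ : ℕ∞) :=
    iInf₂_le _ fun n hn => h D hD ε δ hε hδ hδ1 n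
      ((Nat.lt_floor_add_one _).trans_le (by exact_mod_cast Nat.succ_le_succ hn))
  refine (ENat.toENNReal_le.2 hle).trans ?_
  rcases le_total 0 (bound ε δ) with h0 | h0
  · rw [ENat.toENNReal_coe, ← ENNReal.ofReal_natCast]
    exact ENNReal.ofReal_le_ofReal (Nat.floor_le h0)
  · simp [Nat.floor_of_nonpos h0]

/-- Numbers of examples above `C (M + log (1/δ)) / ε² - 1` satisfy the requirements of
`kernelLearns_of_le`; the `1` accounts for the rounding of the bound to an integer. -/
lemma sample_size_estimates {C M A ℓ ε B : ℝ} {n : ℕ} (hε : 0 < ε) (hℓ : 0 ≤ ℓ)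
    (hCB : 16 * B ^ 2 ≤ C) (hAM : 128 * A ^ 2 ≤ C * M) (hM : 0 ≤ M)
    (hn : C * ((M + ℓ) / ε ^ 2) < n + 1) (hA : ε ≤ A) :
    (8 * A) ^ 2 ≤ n * ε ^ 2 ∧ ℓ * (8 * B ^ 2) < n * ε ^ 2 := by
  have hC : 0 ≤ C := le_trans (by positivity) hCB
  have h1 : C * (M + ℓ) < (n + 1) * ε ^ 2 := by
    rwa [← mul_div_assoc, div_lt_iff₀ (by positivity)] at hn
  have hA2 : ε ^ 2 ≤ A ^ 2 := pow_le_pow_left₀ hε.le hA 2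
  have hε2 : 0 < ε ^ 2 := by positivity
  have hℓB := mul_le_mul_of_nonneg_right hCB hℓ
  -- `n = 0` is excluded by `C M ≥ 128 A² ≥ 128 ε²`, so that `n + 1 ≤ 2 n`
  have hn1 : (1 : ℝ) ≤ n := by
    rcases Nat.eq_zero_or_pos n with rfl | h
    · exfalso
      simp only [Nat.cast_zero, zero_add, one_mul] at h1
      nlinarith [mul_nonneg hC hℓ]
    · exact_mod_cast h
  have h2 : (n + 1) * ε ^ 2 ≤ 2 * (n * ε ^ 2) := by nlinarith
  have h3 := mul_nonneg hC hℓ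
  have h4 := mul_nonneg hC hM
  constructor <;> nlinarith

/-! ### Stochastic gradient descent with a small learning rate -/

section

open Matrix

variable {n m : ℕ}

/-- The error `w - w*` after a step of stochastic gradient descent, if `w*` fits the examples. -/
def sgdErrorStep (η : ℝ) (h : Fin n → Fin m → ℝ) (u : Fin m → ℝ) (i : Fin n) : Fin m → ℝ :=
  u - (η * (u ⬝ᵥ h i)) • h i

lemma foldl_sgdStep_sub {η : ℝ} {h : Fin n → Fin m → ℝ} {y : Fin n → ℝ} {w₀ : Fin m → ℝ}
    (hw₀ : ∀ i, w₀ ⬝ᵥ h i = y i) (l : List (Fin n)) (w : Fin m → ℝ) :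
    l.foldl (sgdStep η h y) w - w₀ = l.foldl (sgdErrorStep η h) (w - w₀) := by
  induction l generalizing w with
  | nil => rfl
  | cons i l ih =>
    rw [List.foldl_cons, List.foldl_cons, ih]
    congr 1
    ext r
    simp only [sgdErrorStep, sub_dotProduct, hw₀]
    simp only [sgdStep, dotProduct, Pi.sub_apply, Pi.smul_apply, smul_eq_mul]
    ring

lemma dotProduct_self_sgdErrorStep_le {η : ℝ} {h : Fin n → Fin m → ℝ} {i : Fin n} (hη : 0 ≤ η)
    (hηh : η * (h i ⬝ᵥ h i) ≤ 1) (u : Fin m → ℝ) :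
    sgdErrorStep η h u i ⬝ᵥ sgdErrorStep η h u i ≤ u ⬝ᵥ u - η * (u ⬝ᵥ h i) ^ 2 := by
  have h1 : sgdErrorStep η h u i ⬝ᵥ sgdErrorStep η h u i =
      u ⬝ᵥ u - 2 * η * (u ⬝ᵥ h i) ^ 2 + η * (u ⬝ᵥ h i) ^ 2 * (η * (h i ⬝ᵥ h i)) := by
    simp only [sgdErrorStep, sub_dotProduct, dotProduct_sub, smul_dotProduct, dotProduct_smul,
      smul_eq_mul, dotProduct_comm (h i) u]
    ring
  have h2 : 0 ≤ η * (u ⬝ᵥ h i) ^ 2 := by positivity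
  rw [h1]
  nlinarith [mul_le_mul_of_nonneg_left hηh h2]

/-- The squared error does not increase, and it is preserved only if the examples that are visited
are fitted. -/
lemma foldl_sgdErrorStep_le {η : ℝ} {h : Fin n → Fin m → ℝ} (hη : 0 < η)
    (hηh : ∀ i, η * (h i ⬝ᵥ h i) ≤ 1) (l : List (Fin n)) (u : Fin m → ℝ) :
    l.foldl (sgdErrorStep η h) u ⬝ᵥ l.foldl (sgdErrorStep η h) u ≤ u ⬝ᵥ u ∧
      (l.foldl (sgdErrorStep η h) u ⬝ᵥ l.foldl (sgdErrorStep η h) u = u ⬝ᵥ u →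
        ∀ i ∈ l, u ⬝ᵥ h i = 0) := by
  induction l generalizing u with
  | nil => simp
  | cons i l ih =>
    obtain ⟨h1, h2⟩ := ih (sgdErrorStep η h u i)
    have h3 := dotProduct_self_sgdErrorStep_le hη.le (hηh i) u
    have h4 : 0 ≤ η * (u ⬝ᵥ h i) ^ 2 := by positivity
    rw [List.foldl_cons]
    refine ⟨by linarith, fun heq => ?_⟩
    have h5 : u ⬝ᵥ h i = 0 := by
      have : η * (u ⬝ᵥ h i) ^ 2 = 0 := by linarith
      rcases mul_eq_zero.1 this with h | h
      · exact absurd h hη.ne'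
      · exact pow_eq_zero_iff (two_ne_zero) |>.1 h
    have h6 : sgdErrorStep η h u i = u := by simp [sgdErrorStep, h5]
    rw [h6] at h2 heq
    exact List.forall_mem_cons.2 ⟨h5, h2 heq⟩

lemma foldl_sgdErrorStep_smul {η : ℝ} {h : Fin n → Fin m → ℝ} (l : List (Fin n)) (c : ℝ)
    (u : Fin m → ℝ) :
    l.foldl (sgdErrorStep η h) (c • u) = c • l.foldl (sgdErrorStep η h) u := by
  induction l generalizing u with
  | nil => rfl
  | cons i l ih =>
    rw [List.foldl_cons, List.foldl_cons, ← ih]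
    congr 1
    simp only [sgdErrorStep, smul_dotProduct, smul_eq_mul, smul_sub, smul_smul]
    ring_nf

lemma continuous_foldl_sgdErrorStep {η : ℝ} {h : Fin n → Fin m → ℝ} (l : List (Fin n)) :
    Continuous fun u => l.foldl (sgdErrorStep η h) u := by
  induction l with
  | nil => exact continuous_id
  | cons i l ih =>
    refine ih.comp ?_
    unfold sgdErrorStep
    simp only [dotProduct]
    fun_prop

lemma foldl_sgdErrorStep_mem_span {η : ℝ} {h : Fin n → Fin m → ℝ} (l : List (Fin n))
    {u : Fin m → ℝ} (hu : u ∈ Submodule.span ℝ (Set.range h)) :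
    l.foldl (sgdErrorStep η h) u ∈ Submodule.span ℝ (Set.range h) := by
  induction l generalizing u with
  | nil => exact hu
  | cons i l ih =>
    exact ih (Submodule.sub_mem _ hu (Submodule.smul_mem _ _ (Submodule.subset_span ⟨i, rfl⟩)))

lemma eq_zero_of_mem_span_of_orthogonal {h : Fin n → Fin m → ℝ} {u : Fin m → ℝ}
    (hu : u ∈ Submodule.span ℝ (Set.range h)) (h0 : ∀ i, u ⬝ᵥ h i = 0) : u = 0 := by
  obtain ⟨c, hc⟩ := (Submodule.mem_span_range_iff_exists_fun ℝ).1 hu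
  refine dotProduct_self_eq_zero.1 ?_
  have h1 : u ⬝ᵥ ∑ i, c i • h i = 0 := by
    rw [dotProduct_sum]
    exact Finset.sum_eq_zero fun i _ => by rw [dotProduct_smul, h0, smul_zero]
  rwa [hc] at h1

/-- An epoch that visits all examples contracts the errors in the span of the hidden layers: by
compactness of the unit sphere of the span, the strict decrease is uniform. -/
lemma exists_epoch_contraction {η : ℝ} {h : Fin n → Fin m → ℝ} (hη : 0 < η)
    (hηh : ∀ i, η * (h i ⬝ᵥ h i) ≤ 1) (l : List (Fin n)) (hl : ∀ i, i ∈ l) :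
    ∃ ρ : ℝ, ρ < 1 ∧ ∀ u ∈ Submodule.span ℝ (Set.range h),
      l.foldl (sgdErrorStep η h) u ⬝ᵥ l.foldl (sgdErrorStep η h) u ≤ ρ * (u ⬝ᵥ u) := by
  set P : (Fin m → ℝ) → Fin m → ℝ := fun u => l.foldl (sgdErrorStep η h) u with hP
  set S : Set (Fin m → ℝ) := {u | u ∈ Submodule.span ℝ (Set.range h) ∧ u ⬝ᵥ u = 1} with hS
  have hdot : Continuous fun u : Fin m → ℝ => u ⬝ᵥ u := by
    simp only [dotProduct]
    fun_prop
  have hcomp : IsCompact S := by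
    refine Metric.isCompact_of_isClosed_isBounded ?_ ?_
    · exact (Submodule.closed_of_finiteDimensional _).inter (isClosed_singleton.preimage hdot)
    · refine (Metric.isBounded_closedBall (x := (0 : Fin m → ℝ)) (r := 1)).subset fun u hu => ?_
      rw [mem_closedBall_zero_iff, pi_norm_le_iff_of_nonneg zero_le_one]
      intro r
      have h1 : u r * u r ≤ u ⬝ᵥ u := Finset.single_le_sum (f := fun r => u r * u r)
        (fun r _ => mul_self_nonneg _) (Finset.mem_univ r)
      rw [hu.2] at h1
      rw [Real.norm_eq_abs, ← sq_le_one_iff_abs_le_one]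
      nlinarith
  have hex : ∃ ρ : ℝ, ρ < 1 ∧ ∀ u ∈ S, P u ⬝ᵥ P u ≤ ρ := by
    rcases S.eq_empty_or_nonempty with hempty | hne
    · exact ⟨0, zero_lt_one, by simp [hempty]⟩
    · obtain ⟨v, hv, hmax⟩ := hcomp.exists_isMaxOn hne
        (hdot.comp (continuous_foldl_sgdErrorStep (η := η) (h := h) l)).continuousOn
      refine ⟨P v ⬝ᵥ P v, lt_of_le_of_ne ?_ ?_, fun u hu => hmax hu⟩
      · rw [← hv.2]
        exact (foldl_sgdErrorStep_le hη hηh l v).1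
      · intro heq
        rw [← hv.2] at heq
        have h0 := eq_zero_of_mem_span_of_orthogonal hv.1 fun i =>
          (foldl_sgdErrorStep_le hη hηh l v).2 heq i (hl i)
        have := hv.2
        rw [h0] at this
        simp at this
  obtain ⟨ρ, hρ, hρS⟩ := hex
  refine ⟨ρ, hρ, fun u hu => ?_⟩
  rcases eq_or_ne u 0 with rfl | hu0
  · have := (foldl_sgdErrorStep_le hη hηh l 0).1
    simpa using this
  · have hpos : 0 < u ⬝ᵥ u := lt_of_le_of_ne
      (Finset.sum_nonneg fun r _ => mul_self_nonneg _) (Ne.symm (by simpa using hu0))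
    have hs : √(u ⬝ᵥ u) * √(u ⬝ᵥ u) = u ⬝ᵥ u := Real.mul_self_sqrt hpos.le
    have hs0 : 0 < √(u ⬝ᵥ u) := Real.sqrt_pos.2 hpos
    have h1 := hρS ((√(u ⬝ᵥ u))⁻¹ • u) ⟨Submodule.smul_mem _ _ hu, by
      rw [smul_dotProduct, dotProduct_smul, smul_eq_mul, smul_eq_mul]
      nth_rw 3 [← hs]
      field_simp⟩
    have h2 : P ((√(u ⬝ᵥ u))⁻¹ • u) = (√(u ⬝ᵥ u))⁻¹ • P u := foldl_sgdErrorStep_smul l _ u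
    rw [h2, smul_dotProduct, dotProduct_smul, smul_eq_mul, smul_eq_mul, ← mul_assoc,
      ← mul_inv, hs, inv_mul_le_iff₀ hpos, mul_comm] at h1
    exact h1

/-- Stochastic gradient descent converges to the solution `w₀` of minimal norm, uniformly in the
orders of the examples: there are finitely many orders for one epoch, so that they share a
contraction factor. -/
theorem sgd_eventually_close {η : ℝ} {h : Fin n → Fin m → ℝ} {y : Fin n → ℝ} (hη : 0 < η)
    (hηh : ∀ i, η * (h i ⬝ᵥ h i) ≤ 1) {w₀ : Fin m → ℝ}
    (hspan : w₀ ∈ Submodule.span ℝ (Set.range h)) (hw₀ : ∀ i, w₀ ⬝ᵥ h i = y i) {τ : ℝ}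
    (hτ : 0 < τ) :
    ∀ᶠ T in Filter.atTop, ∀ order : ℕ → Equiv.Perm (Fin n),
      (sgd η h y order T - w₀) ⬝ᵥ (sgd η h y order T - w₀) < τ := by
  have hcon := fun π : Equiv.Perm (Fin n) => exists_epoch_contraction hη hηh
    ((List.finRange n).map π) fun i => List.mem_map.2 ⟨π.symm i, List.mem_finRange _, by simp⟩
  choose ρ' hρ'1 hρ' using hcon
  set ρ := max (maxFun ρ') 0 with hρdef
  have hρ1 : ρ < 1 := by
    obtain ⟨π, hπ⟩ := exists_eq_maxFun ρ'
    exact max_lt (hπ ▸ hρ'1 π) zero_lt_one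
  have hρ0 : 0 ≤ ρ := le_max_right _ _
  have hpos : ∀ u : Fin m → ℝ, 0 ≤ u ⬝ᵥ u := fun u =>
    Finset.sum_nonneg fun r _ => mul_self_nonneg _
  have hind : ∀ (order : ℕ → Equiv.Perm (Fin n)) (T : ℕ),
      sgd η h y order T - w₀ ∈ Submodule.span ℝ (Set.range h) ∧
      (sgd η h y order T - w₀) ⬝ᵥ (sgd η h y order T - w₀) ≤ ρ ^ T * (w₀ ⬝ᵥ w₀) := by
    intro order T
    induction T with
    | zero =>
      simp only [sgd, zero_sub, pow_zero, one_mul, neg_dotProduct_neg, le_refl, and_true]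
      exact Submodule.neg_mem _ hspan
    | succ T ih =>
      rw [sgd, foldl_sgdStep_sub hw₀]
      refine ⟨foldl_sgdErrorStep_mem_span _ ih.1, (hρ' (order T) _ ih.1).trans ?_⟩
      rw [pow_succ', mul_assoc]
      exact mul_le_mul ((le_maxFun ρ' _).trans (le_max_left _ _)) ih.2 (hpos _) hρ0
  have hlim : Filter.Tendsto (fun T : ℕ => ρ ^ T * (w₀ ⬝ᵥ w₀)) Filter.atTop (nhds 0) := by
    simpa using (tendsto_pow_atTop_nhds_zero_of_lt_one hρ0 hρ1).mul_const (w₀ ⬝ᵥ w₀)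
  filter_upwards [hlim.eventually_lt_const hτ] with T hT order
  exact (hind order T).2.trans_lt hT

end

/-! ### Perturbation of singular linear systems -/

section

open Matrix

variable {n : ℕ}

/-- The solutions of `H *ᵥ α = y` are stable under perturbations `H'` of `H` that vanish on the
kernel of `H`, which is spanned by the columns of `A`: add `A * Aᵀ` to make the system regular. -/
lemma exists_perturbed_solution {H : Matrix (Fin n) (Fin n) ℝ} (hH : Hᵀ = H) {y α : Fin n → ℝ}
    (hα : H *ᵥ α = y) :
    ∃ (A : Matrix (Fin n) (Fin n) ℝ) (Φ : Matrix (Fin n) (Fin n) ℝ → Fin n → ℝ), H * A = 0 ∧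
      Filter.Tendsto Φ (nhds H) (nhds α) ∧
      ∀ᶠ H' in nhds H, H'ᵀ = H' → H' * A = 0 → H' *ᵥ Φ H' = y := by
  obtain ⟨q, hq⟩ : ∃ q : (Fin n → ℝ) →ₗ[ℝ] (Fin n → ℝ), LinearMap.range q = H.mulVecLin.ker := by
    obtain ⟨N', hN'⟩ := H.mulVecLin.ker.exists_isCompl
    exact ⟨_, Submodule.range_projection hN'⟩
  set A : Matrix (Fin n) (Fin n) ℝ := LinearMap.toMatrix' q with hA
  have hAq : ∀ v, A *ᵥ v = q v := fun v => LinearMap.toMatrix'_mulVec q v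
  have hHA : H * A = 0 := by
    refine Matrix.ext_of_mulVec_single fun i => ?_
    rw [← mulVec_mulVec, hAq, zero_mulVec]
    have : q (Pi.single i 1) ∈ H.mulVecLin.ker := hq ▸ LinearMap.mem_range_self q _
    simpa using this
  set P := A * Aᵀ with hP
  have hinj : ∀ u, (H + P) *ᵥ u = 0 → u = 0 := by
    intro u hu
    have h1 : H *ᵥ (H *ᵥ u) = 0 := by
      have h2 : H *ᵥ ((H + P) *ᵥ u) = 0 := by rw [hu, mulVec_zero]
      rwa [add_mulVec, mulVec_add, mulVec_mulVec u H P, hP, ← Matrix.mul_assoc, hHA,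
        Matrix.zero_mul, zero_mulVec, add_zero] at h2
    have h3 : H *ᵥ u = 0 := by
      refine dotProduct_self_eq_zero.1 ?_
      nth_rw 1 [← hH]
      rw [mulVec_transpose, ← dotProduct_mulVec, h1, dotProduct_zero]
    have h4 : P *ᵥ u = 0 := by rwa [add_mulVec, h3, zero_add] at hu
    have h5 : Aᵀ *ᵥ u = 0 := by
      refine dotProduct_self_eq_zero.1 ?_
      nth_rw 1 [mulVec_transpose]
      rw [← dotProduct_mulVec, mulVec_mulVec, ← hP, h4, dotProduct_zero]
    obtain ⟨v, hv⟩ : u ∈ LinearMap.range q := by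
      rw [hq]
      simpa using h3
    refine dotProduct_self_eq_zero.1 ?_
    nth_rw 2 [← hv]
    rw [← hAq, dotProduct_mulVec, ← mulVec_transpose, h5, zero_dotProduct]
  have hdet : (H + P).det ≠ 0 := by
    intro h0
    obtain ⟨v, hv, hv0⟩ := Matrix.exists_mulVec_eq_zero_iff.2 h0
    exact hv (hinj v hv0)
  have hcont : Continuous fun H' : Matrix (Fin n) (Fin n) ℝ => (H' + P).det := by fun_prop
  have hadj : Continuous fun H' : Matrix (Fin n) (Fin n) ℝ => (H' + P).adjugate :=
    (continuous_id.add continuous_const).matrix_adjugate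
  refine ⟨A, fun H' => ((H' + P).det)⁻¹ • (H' + P).adjugate *ᵥ (y + P *ᵥ α), hHA, ?_, ?_⟩
  · have h1 : Filter.Tendsto
        (fun H' : Matrix (Fin n) (Fin n) ℝ =>
          ((H' + P).det)⁻¹ • (H' + P).adjugate *ᵥ (y + P *ᵥ α)) (nhds H)
        (nhds (((H + P).det)⁻¹ • (H + P).adjugate *ᵥ (y + P *ᵥ α))) :=
      ((hcont.tendsto H).inv₀ hdet).smul
        ((hadj.matrix_mulVec continuous_const).tendsto H)
    convert h1 using 2
    rw [← hα, ← add_mulVec, mulVec_mulVec, adjugate_mul, smul_mulVec, one_mulVec, smul_smul,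
      inv_mul_cancel₀ hdet, one_smul]
  · filter_upwards [(hcont.tendsto H).eventually_ne hdet] with H' hd hsym hHA'
    set w := ((H' + P).det)⁻¹ • (H' + P).adjugate *ᵥ (y + P *ᵥ α) with hw
    have h1 : (H' + P) *ᵥ w = y + P *ᵥ α := by
      rw [hw, mulVec_smul, mulVec_mulVec, mul_adjugate, smul_mulVec, one_mulVec, smul_smul,
        inv_mul_cancel₀ hd, one_smul]
    have hAH : ∀ G : Matrix (Fin n) (Fin n) ℝ, Gᵀ = G → G * A = 0 → Aᵀ * G = 0 := by
      intro G hG hGA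
      rw [← hG, ← transpose_mul, hGA, transpose_zero]
    -- `Aᵀ` annihilates `H' *ᵥ w - y`, which is in the range of `A * Aᵀ`
    have h2 : H' *ᵥ w - y = P *ᵥ (α - w) := by
      rw [add_mulVec] at h1
      rw [mulVec_sub]
      linear_combination (exp := 1) h1
    have h3 : Aᵀ *ᵥ (H' *ᵥ w - y) = 0 := by
      rw [mulVec_sub, ← hα, mulVec_mulVec, mulVec_mulVec, hAH H' hsym hHA', hAH H hH hHA,
        zero_mulVec, zero_mulVec, sub_zero]
    refine sub_eq_zero.1 (dotProduct_self_eq_zero.1 ?_)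
    nth_rw 2 [h2]
    rw [hP, ← mulVec_mulVec, dotProduct_mulVec, ← mulVec_transpose, h3, zero_dotProduct]

end

/-! ### Laws of large numbers and iterated limits of failure probabilities -/

section

variable {Ω : Type*} [MeasurableSpace Ω] {ν : Measure Ω} [IsProbabilityMeasure ν]

/-- The `L¹` law of large numbers, for samples of size `m` instead of an infinite sequence. -/
lemma tendsto_lintegral_enorm_mean_sub {F : Ω → ℝ} (hF : Measurable F) (hi : Integrable F ν) :
    Filter.Tendsto (fun m : ℕ => ∫⁻ V : Fin m → Ω, ‖(m : ℝ)⁻¹ * ∑ r, F (V r) - ∫ ω, F ω ∂ν‖ₑ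
      ∂(Measure.pi fun _ => ν)) Filter.atTop (nhds 0) := by
  let μ : Measure (ℕ → Ω) := Measure.infinitePi fun _ => ν
  have heval : ∀ i : ℕ, MeasurePreserving (fun ω : ℕ → Ω => ω i) μ ν := fun i =>
    measurePreserving_eval_infinitePi (fun _ => ν) i
  have hind : ProbabilityTheory.iIndepFun (fun (i : ℕ) (ω : ℕ → Ω) => F (ω i)) μ :=
    ProbabilityTheory.iIndepFun_infinitePi (fun _ => hF)
  have hmean : ∫ ω, F (ω 0) ∂μ = ∫ ω, F ω ∂ν := by
    rw [← (heval 0).map_eq, integral_map (heval 0).measurable.aemeasurable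
      hF.aestronglyMeasurable]
  have h := ProbabilityTheory.strong_law_Lp (μ := μ) (p := 1) le_rfl ENNReal.one_ne_top
    (fun i ω => F (ω i))
    (memLp_one_iff_integrable.2 ((heval 0).integrable_comp_of_integrable hi))
    (fun i j hij => hind.indepFun hij)
    (fun i => ⟨(hF.comp (heval i).measurable).aemeasurable,
      (hF.comp (heval 0).measurable).aemeasurable, by
        change μ.map (F ∘ fun ω : ℕ → Ω => ω i) = μ.map (F ∘ fun ω : ℕ → Ω => ω 0)
        rw [← Measure.map_map hF (heval i).measurable, ← Measure.map_map hF (heval 0).measurable,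
          (heval i).map_eq, (heval 0).map_eq]⟩)
  refine h.congr fun m => ?_
  have hmap : μ.map (fun (ω : ℕ → Ω) (r : Fin m) => ω r) = Measure.pi fun _ => ν := by
    rw [← Measure.infinitePi_eq_pi]
    exact Measure.map_infinitePi_infinitePi_of_inj (P := fun _ : ℕ => ν) Fin.val_injective
  rw [← hmap, lintegral_map (by fun_prop) (by fun_prop), eLpNorm_one_eq_lintegral_enorm]
  refine lintegral_congr fun ω => ?_
  rw [hmean, smul_eq_mul, Finset.sum_range]

lemma lintegral_enorm_mean_sub_le {F : Ω → ℝ} (hF : Measurable F) (m : ℕ) :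
    ∫⁻ V : Fin m → Ω, ‖(m : ℝ)⁻¹ * ∑ r, F (V r) - ∫ ω, F ω ∂ν‖ₑ ∂(Measure.pi fun _ => ν) ≤
      2 * ∫⁻ ω, ‖F ω‖ₑ ∂ν := by
  have hr : ∀ r : Fin m, ∫⁻ V : Fin m → Ω, ‖F (V r)‖ₑ ∂(Measure.pi fun _ => ν) =
      ∫⁻ ω, ‖F ω‖ₑ ∂ν := fun r =>
    (measurePreserving_eval (fun _ : Fin m => ν) r).lintegral_comp hF.enorm
  calc _ ≤ ∫⁻ V : Fin m → Ω, (‖(m : ℝ)⁻¹‖ₑ * ∑ r, ‖F (V r)‖ₑ + ‖∫ ω, F ω ∂ν‖ₑ)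
        ∂(Measure.pi fun _ => ν) := by
        refine lintegral_mono fun V => (enorm_sub_le).trans ?_
        rw [enorm_mul]
        gcongr
        exact enorm_sum_le _ _
    _ = ‖(m : ℝ)⁻¹‖ₑ * (m * ∫⁻ ω, ‖F ω‖ₑ ∂ν) + ‖∫ ω, F ω ∂ν‖ₑ := by
        rw [lintegral_add_right _ measurable_const, lintegral_const_mul _ (by fun_prop),
          lintegral_finsetSum _ (fun r _ => by fun_prop)]
        simp [hr]
    _ ≤ ∫⁻ ω, ‖F ω‖ₑ ∂ν + ∫⁻ ω, ‖F ω‖ₑ ∂ν := by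
        refine add_le_add ?_ (enorm_integral_le_lintegral_enorm _)
        rw [← mul_assoc]
        refine mul_le_of_le_one_left' ?_
        rcases Nat.eq_zero_or_pos m with rfl | hm
        · simp
        · rw [show (m : ℝ≥0∞) = ‖(m : ℝ)‖ₑ by simp, ← enorm_mul,
            inv_mul_cancel₀ (by positivity)]
          simp
    _ = 2 * ∫⁻ ω, ‖F ω‖ₑ ∂ν := (two_mul _).symm

end

/-- The reverse Fatou lemma for events that are parametrized by a countably generated filter. -/
lemma exists_measurableSet_frequently {Θ ι : Type*} [MeasurableSpace Θ] (μ : Measure Θ)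
    [IsFiniteMeasure μ] {l : Filter ι} [l.IsCountablyGenerated] {S : ι → Set Θ} {c : ℝ≥0∞}
    (h : ∃ᶠ i in l, ∃ M, MeasurableSet M ∧ M ⊆ S i ∧ c ≤ μ M) :
    ∃ M, MeasurableSet M ∧ M ⊆ {θ | ∃ᶠ i in l, θ ∈ S i} ∧ c ≤ μ M := by
  obtain ⟨s, hs, hM⟩ := Filter.exists_seq_forall_of_frequently h
  choose M hMm hMS hMc using hM
  refine ⟨⋂ N, ⋃ k ≥ N, M k, MeasurableSet.iInter fun N => MeasurableSet.biUnion
    (Set.to_countable _) fun k _ => hMm k, fun θ hθ => ?_, ?_⟩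
  · refine hs.frequently (Filter.frequently_atTop.2 fun N => ?_)
    obtain ⟨k, hk⟩ := Set.mem_iUnion.1 (Set.mem_iInter.1 hθ N)
    obtain ⟨hkN, hk⟩ := Set.mem_iUnion.1 hk
    exact ⟨k, hkN, hMS k hk⟩
  · have hanti : Antitone fun N => ⋃ k ≥ N, M k := fun N N' hNN' =>
      Set.biUnion_subset_biUnion_left fun k hk => le_trans hNN' hk
    rw [hanti.measure_iInter (fun N => (MeasurableSet.biUnion (Set.to_countable _)
      fun k _ => hMm k).nullMeasurableSet) ⟨0, measure_ne_top _ _⟩]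
    exact le_iInf fun N => (hMc N).trans (measure_mono (Set.subset_biUnion_of_mem
      (u := fun k => M k) (show N ∈ {k | k ≥ N} by simp)))

/-- If for all samples `x` outside of `A` the conditional probability of the failure of training with
small learning rates and many epochs vanishes in the limit of infinite width `m`, then the failure
probabilities are eventually less than any `c > P A`. As `F` may depend on an order `o` out of
uncountably many, failure in the iterated limit need not be a measurable event; the reverse Fatou
lemma provides a measurable part of it. -/
theorem eventually_measure_prod_lt {X : Type*} [MeasurableSpace X] {P : Measure X}
    [IsProbabilityMeasure P] {Ω : ℕ → Type*} [∀ m, MeasurableSpace (Ω m)]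
    {ν : ∀ m, Measure (Ω m)} [∀ m, IsProbabilityMeasure (ν m)] {O : Type*}
    {F : ∀ m, ℝ → ℕ → O → Set (Ω m × X)} (hF : ∀ m η T o, MeasurableSet (F m η T o))
    {A : Set X} {c : ℝ≥0∞} (hA : P A < c)
    (hlim : ∀ x ∉ A, Filter.Tendsto (fun m => ν m {V | ¬ ∀ᶠ η in nhdsWithin 0 (Set.Ioi 0),
      ∀ᶠ T in Filter.atTop, ∀ o, (V, x) ∉ F m η T o}) Filter.atTop (nhds 0)) :
    ∀ᶠ m in Filter.atTop, ∀ᶠ η in nhdsWithin 0 (Set.Ioi 0), ∀ᶠ T in Filter.atTop, ∀ o,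
      ((ν m).prod P) (F m η T o) < c := by
  have hM : ∀ m, ∃ M : Set (Ω m × X), MeasurableSet M ∧
      M ⊆ {θ | ¬ ∀ᶠ η in nhdsWithin 0 (Set.Ioi 0), ∀ᶠ T in Filter.atTop, ∀ o, θ ∉ F m η T o} ∧
      (¬ (∀ᶠ η in nhdsWithin 0 (Set.Ioi 0), ∀ᶠ T in Filter.atTop, ∀ o,
        ((ν m).prod P) (F m η T o) < c) → c ≤ ((ν m).prod P) M) := by
    intro m
    by_cases hbad : ∀ᶠ η in nhdsWithin 0 (Set.Ioi 0), ∀ᶠ T in Filter.atTop, ∀ o,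
        ((ν m).prod P) (F m η T o) < c
    · exact ⟨∅, MeasurableSet.empty, Set.empty_subset _, fun h => absurd hbad h⟩
    · simp only [Filter.not_eventually, not_forall, not_lt, not_not] at hbad ⊢
      have h1 := exists_measurableSet_frequently ((ν m).prod P)
        (S := fun η => {θ | ∃ᶠ T in Filter.atTop, ∃ o, θ ∈ F m η T o}) (c := c)
        (hbad.mono fun η hη => exists_measurableSet_frequently ((ν m).prod P)
          (S := fun T => {θ | ∃ o, θ ∈ F m η T o})
          (hη.mono fun T ⟨o, ho⟩ => ⟨F m η T o, hF m η T o, fun θ hθ => ⟨o, hθ⟩, ho⟩))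
      obtain ⟨M, hM1, hM2, hM3⟩ := h1
      exact ⟨M, hM1, hM2, fun _ => hM3⟩
  choose M hMm hMsub hMc using hM
  set A' := toMeasurable P A with hA'
  have hA'm : MeasurableSet A' := measurableSet_toMeasurable P A
  have hlim2 : Filter.Tendsto (fun m => ∫⁻ x in A'ᶜ, ν m ((fun V => (V, x)) ⁻¹' M m) ∂P)
      Filter.atTop (nhds 0) := by
    have := tendsto_lintegral_of_dominated_convergence (μ := P.restrict A'ᶜ)
      (F := fun m x => ν m ((fun V => (V, x)) ⁻¹' M m)) (f := fun _ => 0) (fun _ => 1)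
      (fun m => measurable_measure_prodMk_right (hMm m))
      (fun m => Filter.Eventually.of_forall fun x => prob_le_one) (by simp) ?_
    · simpa using this
    · refine (ae_restrict_iff' hA'm.compl).2 (Filter.Eventually.of_forall fun x hx => ?_)
      refine tendsto_of_tendsto_of_tendsto_of_le_of_le tendsto_const_nhds
        (hlim x fun hxA => hx (subset_toMeasurable P A hxA)) (fun _ => zero_le) fun m => ?_
      exact measure_mono fun V hV => hMsub m hV
  have hgap : 0 < c - P A := tsub_pos_of_lt hA
  filter_upwards [hlim2.eventually_lt_const hgap] with m hm
  by_contra hbad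
  refine absurd (hMc m hbad) (not_le.2 ?_)
  rw [Measure.prod_apply_symm (hMm m), ← lintegral_add_compl _ hA'm]
  have h1 : ∫⁻ x in A', ν m ((fun V => (V, x)) ⁻¹' M m) ∂P ≤ P A := by
    calc _ ≤ ∫⁻ _ in A', 1 ∂P := lintegral_mono fun x => prob_le_one
      _ = P A := by rw [setLIntegral_one, hA', measure_toMeasurable]
  calc _ ≤ P A + ∫⁻ x in A'ᶜ, ν m ((fun V => (V, x)) ⁻¹' M m) ∂P := add_le_add_left h1 _
    _ < P A + (c - P A) := ENNReal.add_lt_add_left (measure_ne_top _ _) hm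
    _ = c := add_tsub_cancel_of_le hA.le

/-! ### The random kernel of a network of finite width -/

section

variable {d n m : ℕ} {σ : ℝ → ℝ} {ν : Measure (EuclideanSpace ℝ (Fin d) × ℝ)} {b : ℕ → ℝ}

/-- The random kernel of the hidden layer with weights `V`. -/
def networkKernel (σ : ℝ → ℝ) (V : Fin m → EuclideanSpace ℝ (Fin d) × ℝ) (x z : UnitSphere d) : ℝ :=
  hiddenLayer σ V x ⬝ᵥ hiddenLayer σ V z

lemma networkKernel_eq_mean (V : Fin m → EuclideanSpace ℝ (Fin d) × ℝ) (x z : UnitSphere d) :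
    networkKernel σ V x z =
      (m : ℝ)⁻¹ * ∑ r, hiddenUnit σ (V r) x * hiddenUnit σ (V r) z := by
  simp only [networkKernel, dotProduct, hiddenLayer]
  rw [Finset.mul_sum]
  refine Finset.sum_congr rfl fun r _ => ?_
  rw [div_mul_div_comm, Real.mul_self_sqrt (by positivity)]
  ring

lemma networkKernel_comm (V : Fin m → EuclideanSpace ℝ (Fin d) × ℝ) (x z : UnitSphere d) :
    networkKernel σ V x z = networkKernel σ V z x :=
  dotProduct_comm _ _

lemma measurable_hiddenUnit (hσ : Measurable σ) :
    Measurable fun q : (EuclideanSpace ℝ (Fin d) × ℝ) × UnitSphere d => hiddenUnit σ q.1 q.2 := by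
  unfold hiddenUnit
  refine hσ.comp ?_
  fun_prop

@[fun_prop]
lemma Measurable.hiddenUnit {Z : Type*} [MeasurableSpace Z] (hσ : Measurable σ)
    {v : Z → EuclideanSpace ℝ (Fin d) × ℝ} (hv : Measurable v) {x : Z → UnitSphere d}
    (hx : Measurable x) : Measurable fun q => hiddenUnit σ (v q) (x q) :=
  (measurable_hiddenUnit hσ).comp (hv.prodMk hx)

@[fun_prop]
lemma Measurable.hiddenLayer {Z : Type*} [MeasurableSpace Z] (hσ : Measurable σ)
    {V : Z → Fin m → EuclideanSpace ℝ (Fin d) × ℝ} (hV : Measurable V) {x : Z → UnitSphere d}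
    (hx : Measurable x) (r : Fin m) : Measurable fun q => hiddenLayer σ (V q) (x q) r := by
  unfold _root_.hiddenLayer
  fun_prop

@[fun_prop]
lemma Measurable.networkKernel {Z : Type*} [MeasurableSpace Z] (hσ : Measurable σ)
    {V : Z → Fin m → EuclideanSpace ℝ (Fin d) × ℝ} (hV : Measurable V) {x z : Z → UnitSphere d}
    (hx : Measurable x) (hz : Measurable z) :
    Measurable fun q => networkKernel σ (V q) (x q) (z q) := by
  unfold _root_.networkKernel dotProduct
  fun_prop

lemma lintegral_enorm_hiddenUnit_mul_le (hK : HasNNGPKernel σ ν b)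
    (x z : UnitSphere d) :
    ∫⁻ v, ‖hiddenUnit σ v x * hiddenUnit σ v z‖ₑ ∂ν ≤ ENNReal.ofReal (∑' k, b k) := by
  have hx := hK x x
  have hz := hK z z
  rw [dotKernel_self] at hx hz
  have hint : ∫ v, (hiddenUnit σ v x * hiddenUnit σ v x + hiddenUnit σ v z * hiddenUnit σ v z) / 2
      ∂ν = ∑' k, b k := by
    rw [integral_div, integral_add hx.1 hz.1, hx.2, hz.2]
    ring
  have hi : Integrable (fun v => (hiddenUnit σ v x * hiddenUnit σ v x +
      hiddenUnit σ v z * hiddenUnit σ v z) / 2) ν := (hx.1.add hz.1).div_const 2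
  rw [← hint, ofReal_integral_eq_lintegral_ofReal hi
    (Filter.Eventually.of_forall fun v => by
      simp only [Pi.zero_apply]
      nlinarith [mul_self_nonneg (hiddenUnit σ v x), mul_self_nonneg (hiddenUnit σ v z)])]
  refine lintegral_mono fun v => ?_
  rw [← ofReal_norm]
  refine ENNReal.ofReal_le_ofReal ?_
  rw [Real.norm_eq_abs, abs_le]
  constructor <;>
    nlinarith [sq_nonneg (hiddenUnit σ v x + hiddenUnit σ v z),
      sq_nonneg (hiddenUnit σ v x - hiddenUnit σ v z)]

/-- The random kernel of a wide network is close to its mean in `L¹`, on average over the pairs of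
inputs with respect to any finite measure. -/
lemma tendsto_lintegral_networkKernel_sub [IsProbabilityMeasure ν] (hb : SlowlyDecaying b)
    (hσ : Measurable σ) (hK : HasNNGPKernel σ ν b) (ρ : Measure (UnitSphere d × UnitSphere d))
    [IsFiniteMeasure ρ] :
    Filter.Tendsto (fun m : ℕ => ∫⁻ V : Fin m → EuclideanSpace ℝ (Fin d) × ℝ,
      ∫⁻ q, ‖networkKernel σ V q.1 q.2 - dotKernel b q.1 q.2‖ₑ ∂ρ ∂(Measure.pi fun _ => ν))
      Filter.atTop (nhds 0) := by
  have hKm := (continuous_dotKernel hb d).measurable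
  have hmeas : ∀ m : ℕ, Measurable fun q : (Fin m → EuclideanSpace ℝ (Fin d) × ℝ) ×
      (UnitSphere d × UnitSphere d) =>
      ‖networkKernel σ q.1 q.2.1 q.2.2 - dotKernel b q.2.1 q.2.2‖ₑ := fun m =>
    ((Measurable.networkKernel hσ measurable_fst (by fun_prop) (by fun_prop)).sub
      (hKm.comp measurable_snd)).enorm
  have hF : ∀ q : UnitSphere d × UnitSphere d,
      Measurable fun v => hiddenUnit σ v q.1 * hiddenUnit σ v q.2 := fun q => by fun_prop
  have heq : ∀ (m : ℕ) (V : Fin m → EuclideanSpace ℝ (Fin d) × ℝ)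
      (q : UnitSphere d × UnitSphere d),
      networkKernel σ V q.1 q.2 - dotKernel b q.1 q.2 =
      (m : ℝ)⁻¹ * ∑ r, hiddenUnit σ (V r) q.1 * hiddenUnit σ (V r) q.2 -
        ∫ v, hiddenUnit σ v q.1 * hiddenUnit σ v q.2 ∂ν := fun m V q => by
    rw [networkKernel_eq_mean, (hK q.1 q.2).2]
  have hswap : ∀ m : ℕ, ∫⁻ V : Fin m → EuclideanSpace ℝ (Fin d) × ℝ,
      ∫⁻ q, ‖networkKernel σ V q.1 q.2 - dotKernel b q.1 q.2‖ₑ ∂ρ ∂(Measure.pi fun _ => ν) =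
      ∫⁻ q, ∫⁻ V : Fin m → EuclideanSpace ℝ (Fin d) × ℝ,
        ‖networkKernel σ V q.1 q.2 - dotKernel b q.1 q.2‖ₑ ∂(Measure.pi fun _ => ν) ∂ρ :=
    fun m => lintegral_lintegral_swap (hmeas m).aemeasurable
  simp_rw [hswap]
  have h := tendsto_lintegral_of_dominated_convergence (μ := ρ)
    (F := fun (m : ℕ) q => ∫⁻ V : Fin m → EuclideanSpace ℝ (Fin d) × ℝ,
      ‖networkKernel σ V q.1 q.2 - dotKernel b q.1 q.2‖ₑ ∂(Measure.pi fun _ => ν))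
    (f := fun _ => 0) (fun _ => 2 * ENNReal.ofReal (∑' k, b k))
    (fun m => (hmeas m).lintegral_prod_left')
    (fun m => Filter.Eventually.of_forall fun q => ?_) ?_
    (Filter.Eventually.of_forall fun q => ?_)
  · simpa using h
  · refine (lintegral_congr fun V => by rw [heq]).trans_le
      ((lintegral_enorm_mean_sub_le (ν := ν) (hF q) m).trans ?_)
    exact mul_le_mul_right (lintegral_enorm_hiddenUnit_mul_le hK q.1 q.2) _
  · rw [lintegral_const]
    exact ENNReal.mul_ne_top (ENNReal.mul_ne_top (by simp) ENNReal.ofReal_ne_top)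
      (measure_ne_top _ _)
  · exact (tendsto_lintegral_enorm_mean_sub (ν := ν) (hF q) (hK q.1 q.2).1).congr
      fun m => lintegral_congr fun V => by rw [heq]

/-- A linear relation between the features of the limit kernel holds almost surely between the
hidden layers of the random network. -/
lemma ae_sum_smul_hiddenLayer_eq_zero [IsProbabilityMeasure ν]
    (hK : HasNNGPKernel σ ν b) (x : Fin n → UnitSphere d) {u : Fin n → ℝ}
    (hu : ∀ i, ∑ j, dotKernel b (x i) (x j) * u j = 0) (m : ℕ) :
    ∀ᵐ V : Fin m → EuclideanSpace ℝ (Fin d) × ℝ ∂(Measure.pi fun _ => ν),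
      ∑ j, u j • hiddenLayer σ V (x j) = 0 := by
  have hsq : ∀ v, (∑ j, u j * hiddenUnit σ v (x j)) ^ 2 =
      ∑ i, u i * ∑ j, (hiddenUnit σ v (x i) * hiddenUnit σ v (x j)) * u j := fun v => by
    rw [pow_two, Finset.sum_mul_sum]
    refine Finset.sum_congr rfl fun i _ => ?_
    rw [Finset.mul_sum]
    exact Finset.sum_congr rfl fun j _ => by ring
  have hi : ∀ i, Integrable
      (fun v => ∑ j, (hiddenUnit σ v (x i) * hiddenUnit σ v (x j)) * u j) ν := fun i =>
    integrable_finsetSum _ fun j _ => (hK (x i) (x j)).1.mul_const _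
  have hzero : ∫ v, (∑ j, u j * hiddenUnit σ v (x j)) ^ 2 ∂ν = 0 := by
    simp_rw [hsq]
    rw [integral_finsetSum _ fun i _ => (hi i).const_mul _]
    refine Finset.sum_eq_zero fun i _ => ?_
    rw [integral_const_mul, integral_finsetSum _ fun j _ => (hK (x i) (x j)).1.mul_const _]
    simp_rw [integral_mul_const, (hK _ _).2]
    rw [hu i, mul_zero]
  have hint : Integrable (fun v => (∑ j, u j * hiddenUnit σ v (x j)) ^ 2) ν := by
    simp_rw [hsq]
    exact integrable_finsetSum _ fun i _ => (hi i).const_mul _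
  have hae := (integral_eq_zero_iff_of_nonneg (fun v => sq_nonneg _) hint).1 hzero
  have hall : ∀ r : Fin m, ∀ᵐ V : Fin m → EuclideanSpace ℝ (Fin d) × ℝ ∂(Measure.pi fun _ => ν),
      ∑ j, u j * hiddenUnit σ (V r) (x j) = 0 := fun r => by
    have := (measurePreserving_eval (fun _ : Fin m => ν) r).quasiMeasurePreserving.ae hae
    filter_upwards [this] with V hV
    exact pow_eq_zero_iff two_ne_zero |>.1 hV
  filter_upwards [ae_all_iff.2 hall] with V hV
  ext r
  have h1 : (∑ j, u j • hiddenLayer σ V (x j)) r =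
      (∑ j, u j * hiddenUnit σ (V r) (x j)) / √m := by
    simp only [Finset.sum_apply, Pi.smul_apply, smul_eq_mul, hiddenLayer, Finset.sum_div,
      mul_div_assoc]
  rw [h1, hV r, zero_div]
  rfl

end

/-! ### The networks learn what the kernel learns -/

section

variable {d n m : ℕ} {σ : ℝ → ℝ} {ν : Measure (EuclideanSpace ℝ (Fin d) × ℝ)} {b : ℕ → ℝ}

lemma risk_le_add {X : Type*} [MeasurableSpace X] {L : ℝ → ℝ → ℝ} (hL : IsLoss L) (D : Measure X)
    (f f₁ f₂ : X → ℝ) (hm : Measurable fun z => f₂ z - f₁ z) :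
    risk L D f f₂ ≤ risk L D f f₁ + ∫⁻ z, ‖f₂ z - f₁ z‖ₑ ∂D := by
  rw [risk, risk, ← lintegral_add_right _ hm.enorm]
  refine lintegral_mono fun z => ?_
  have h := (hL.lipschitz (f z)).dist_le_mul (f₂ z) (f₁ z)
  simp only [Real.dist_eq, NNReal.coe_one, one_mul] at h
  rw [← ofReal_norm, Real.norm_eq_abs, ← ENNReal.ofReal_add (hL.nonneg _ _) (abs_nonneg _)]
  exact ENNReal.ofReal_le_ofReal (by linarith [le_abs_self (L (f z) (f₂ z) - L (f z) (f₁ z))])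

lemma abs_dotProduct_le_sqrt_mul_sqrt (u v : Fin m → ℝ) :
    |u ⬝ᵥ v| ≤ √(u ⬝ᵥ u) * √(v ⬝ᵥ v) := by
  have h := Finset.sum_mul_sq_le_sq_mul_sq Finset.univ u v
  have hpos : 0 ≤ u ⬝ᵥ u := Finset.sum_nonneg fun r _ => mul_self_nonneg _
  rw [← Real.sqrt_mul hpos, ← Real.sqrt_sq_eq_abs]
  refine Real.sqrt_le_sqrt (h.trans (le_of_eq ?_))
  simp only [dotProduct, pow_two]

/-- For fixed hidden weights, the trained network approaches the interpolant of minimal norm. -/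
lemma eventually_risk_networkModel_lt {L : ℝ → ℝ → ℝ} (hL : IsLoss L) (hσ : Measurable σ)
    {D : Measure (UnitSphere d)} {V : Fin m → EuclideanSpace ℝ (Fin d) × ℝ}
    {x : Fin n → UnitSphere d} {f : UnitSphere d → ℝ} {w : Fin n → ℝ}
    (hw : ∀ i, ∑ j, w j * networkKernel σ V (x j) (x i) = f (x i))
    (hJ : ∫⁻ z, ENNReal.ofReal √(networkKernel σ V z z) ∂D ≠ ⊤) {ε : ℝ≥0∞}
    (hrisk : risk L D f (fun z => ∑ j, w j * networkKernel σ V (x j) z) < ε) :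
    ∀ᶠ η in nhdsWithin 0 (Set.Ioi 0), ∀ᶠ T in Filter.atTop,
      ∀ order : ℕ → Equiv.Perm (Fin n),
        risk L D f (networkModel σ V η order T x fun i => f (x i)) < ε := by
  set h : Fin n → Fin m → ℝ := fun i => hiddenLayer σ V (x i) with hh
  set w₀ : Fin m → ℝ := ∑ j, w j • h j with hw₀
  have hw₀z : ∀ z, w₀ ⬝ᵥ hiddenLayer σ V z = ∑ j, w j * networkKernel σ V (x j) z := fun z => by
    rw [hw₀, sum_dotProduct]
    exact Finset.sum_congr rfl fun j _ => smul_dotProduct _ _ _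
  have hspan : w₀ ∈ Submodule.span ℝ (Set.range h) :=
    Submodule.sum_mem _ fun j _ => Submodule.smul_mem _ _ (Submodule.subset_span ⟨j, rfl⟩)
  obtain ⟨gap, hgap0, hgap⟩ := ENNReal.lt_iff_exists_add_pos_lt.1 hrisk
  obtain ⟨s, hs0, hs⟩ := ENNReal.exists_nnreal_pos_mul_lt hJ
    (ENNReal.coe_ne_zero.2 hgap0.ne')
  have hη : ∀ᶠ η in nhdsWithin (0 : ℝ) (Set.Ioi 0), ∀ i, η * (h i ⬝ᵥ h i) ≤ 1 := by
    refine Filter.eventually_all.2 fun i => ?_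
    have ht : Filter.Tendsto (fun η : ℝ => η * (h i ⬝ᵥ h i)) (nhdsWithin 0 (Set.Ioi 0))
        (nhds 0) := by
      have : Filter.Tendsto (fun η : ℝ => η * (h i ⬝ᵥ h i)) (nhds 0) (nhds (0 * (h i ⬝ᵥ h i))) :=
        (continuous_id.mul continuous_const).tendsto 0
      rw [zero_mul] at this
      exact this.mono_left nhdsWithin_le_nhds
    exact ht.eventually_le_const zero_lt_one
  filter_upwards [hη, self_mem_nhdsWithin] with η hηh hη0
  filter_upwards [sgd_eventually_close (y := fun i => f (x i)) hη0 hηh hspan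
    (fun i => (hw₀z (x i)).trans (hw i)) (τ := (s : ℝ) ^ 2) (by positivity)] with T hT order
  set u := sgd η h (fun i => f (x i)) order T - w₀ with hu
  have hdiff : ∀ z, networkModel σ V η order T x (fun i => f (x i)) z -
      ∑ j, w j * networkKernel σ V (x j) z = u ⬝ᵥ hiddenLayer σ V z := fun z => by
    rw [← hw₀z, hu, sub_dotProduct]
    rfl
  have hmeas : Measurable fun z => networkModel σ V η order T x (fun i => f (x i)) z -
      ∑ j, w j * networkKernel σ V (x j) z := by
    simp_rw [hdiff, dotProduct]
    fun_prop
  refine (risk_le_add hL D f _ _ hmeas).trans_lt (lt_of_le_of_lt ?_ hgap)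
  refine add_le_add_right (le_trans ?_ hs.le) _
  rw [← lintegral_const_mul' _ _ ENNReal.coe_ne_top]
  refine lintegral_mono fun z => ?_
  rw [hdiff, ← ofReal_norm, ← ENNReal.ofReal_coe_nnreal,
    ← ENNReal.ofReal_mul (NNReal.coe_nonneg s)]
  refine ENNReal.ofReal_le_ofReal ((abs_dotProduct_le_sqrt_mul_sqrt _ _).trans ?_)
  refine mul_le_mul_of_nonneg_right ?_ (Real.sqrt_nonneg _)
  exact Real.sqrt_le_iff.2 ⟨s.2, (hT order).le⟩

/-- A measure on pairs of inputs: the sum of the Dirac measures at the pairs of examples, of the laws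
of the pairs of an example and a random input, and of the law of the diagonal pairs. Closeness of
the network kernel to the limit kernel in `L¹` of this measure is all that the comparison of the
trained network to the kernel model needs. -/
def testMeasure (D : Measure (UnitSphere d)) (x : Fin n → UnitSphere d) :
    Measure (UnitSphere d × UnitSphere d) :=
  (∑ q : Fin n × Fin n, Measure.dirac (x q.1, x q.2)) +
    ((∑ j, D.map fun z => (x j, z)) + D.map fun z => (z, z))

instance (D : Measure (UnitSphere d)) [IsProbabilityMeasure D] (x : Fin n → UnitSphere d) :
    IsFiniteMeasure (testMeasure D x) := by
  unfold testMeasure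
  infer_instance

lemma le_lintegral_testMeasure (D : Measure (UnitSphere d)) (x : Fin n → UnitSphere d)
    {G : UnitSphere d × UnitSphere d → ℝ≥0∞} (hG : Measurable G) :
    (∀ i j, G (x i, x j) ≤ ∫⁻ q, G q ∂(testMeasure D x)) ∧
    (∀ j, ∫⁻ z, G (x j, z) ∂D ≤ ∫⁻ q, G q ∂(testMeasure D x)) ∧
    ∫⁻ z, G (z, z) ∂D ≤ ∫⁻ q, G q ∂(testMeasure D x) := by
  have heq : ∫⁻ q, G q ∂(testMeasure D x) = (∑ q : Fin n × Fin n, G (x q.1, x q.2)) +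
      ((∑ j, ∫⁻ z, G (x j, z) ∂D) + ∫⁻ z, G (z, z) ∂D) := by
    rw [testMeasure, lintegral_add_measure, lintegral_add_measure, lintegral_finsetSum_measure,
      lintegral_finsetSum_measure, lintegral_map hG (by fun_prop)]
    congr 1
    · exact Finset.sum_congr rfl fun q _ => lintegral_dirac' _ hG
    · congr 1
      exact Finset.sum_congr rfl fun j _ => lintegral_map hG (by fun_prop)
  rw [heq]
  refine ⟨fun i j => ?_, fun j => ?_, ?_⟩
  · exact (Finset.single_le_sum (f := fun q : Fin n × Fin n => G (x q.1, x q.2))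
      (fun _ _ => zero_le) (Finset.mem_univ (i, j))).trans le_self_add
  · exact (Finset.single_le_sum (f := fun j => ∫⁻ z, G (x j, z) ∂D)
      (fun _ _ => zero_le) (Finset.mem_univ j)).trans (le_self_add.trans le_add_self)
  · exact le_add_self.trans le_add_self

lemma abs_dotKernel_le (hb : SlowlyDecaying b) (x z : UnitSphere d) :
    |dotKernel b x z| ≤ ∑' k, b k := by
  rw [dotKernel, kernelProfile, ← Real.norm_eq_abs]
  refine tsum_of_norm_bounded hb.summable.hasSum fun k => ?_
  rw [norm_mul, norm_pow, Real.norm_of_nonneg (hb.pos k).le, Real.norm_eq_abs]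
  exact mul_le_of_le_one_right (hb.pos k).le
    (pow_le_one₀ (abs_nonneg _) (abs_inner_unitSphere_le _ _))

lemma lintegral_enorm_sum_mul_sub_le {X : Type*} [MeasurableSpace X] (D : Measure X)
    [IsProbabilityMeasure D] {k k₀ : Fin n → X → ℝ} (hk : ∀ j, Measurable (k j))
    (hk₀ : ∀ j, Measurable (k₀ j)) {κ : ℝ} (hκ : ∀ j z, |k₀ j z| ≤ κ) {w α : Fin n → ℝ}
    {s t : ℝ≥0∞} (hwα : ∀ j, ‖w j - α j‖ₑ ≤ s) (ht : ∀ j, ∫⁻ z, ‖k j z - k₀ j z‖ₑ ∂D ≤ t) :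
    ∫⁻ z, ‖∑ j, w j * k j z - ∑ j, α j * k₀ j z‖ₑ ∂D ≤
      t * ∑ j, (‖α j‖ₑ + s) + s * ∑ _j : Fin n, ENNReal.ofReal κ := by
  have hwj : ∀ j, ‖w j‖ₑ ≤ ‖α j‖ₑ + s := fun j => by
    calc ‖w j‖ₑ = ‖α j + (w j - α j)‖ₑ := by rw [add_sub_cancel]
      _ ≤ ‖α j‖ₑ + ‖w j - α j‖ₑ := enorm_add_le _ _
      _ ≤ ‖α j‖ₑ + s := add_le_add_right (hwα j) _
  have hm : ∀ j, Measurable fun z => ‖k j z - k₀ j z‖ₑ := fun j => ((hk j).sub (hk₀ j)).enorm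
  calc ∫⁻ z, ‖∑ j, w j * k j z - ∑ j, α j * k₀ j z‖ₑ ∂D
      ≤ ∫⁻ z, ∑ j, ((‖α j‖ₑ + s) * ‖k j z - k₀ j z‖ₑ + s * ENNReal.ofReal κ) ∂D := by
        refine lintegral_mono fun z => ?_
        rw [← Finset.sum_sub_distrib]
        refine (enorm_sum_le _ _).trans (Finset.sum_le_sum fun j _ => ?_)
        rw [show w j * k j z - α j * k₀ j z =
          w j * (k j z - k₀ j z) + (w j - α j) * k₀ j z by ring]
        refine (enorm_add_le _ _).trans ?_
        rw [enorm_mul, enorm_mul]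
        refine add_le_add (mul_le_mul_left (hwj j) _) (mul_le_mul' (hwα j) ?_)
        rw [← ofReal_norm]
        exact ENNReal.ofReal_le_ofReal (hκ j z)
    _ = ∑ j, ((‖α j‖ₑ + s) * ∫⁻ z, ‖k j z - k₀ j z‖ₑ ∂D + s * ENNReal.ofReal κ) := by
        rw [lintegral_finsetSum _ fun j _ => ((hm j).const_mul _).add_const _]
        refine Finset.sum_congr rfl fun j _ => ?_
        rw [lintegral_add_right _ measurable_const, lintegral_const_mul _ (hm j),
          lintegral_const, measure_univ, mul_one]
    _ ≤ ∑ j, ((‖α j‖ₑ + s) * t + s * ENNReal.ofReal κ) :=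
        Finset.sum_le_sum fun j _ => add_le_add_left (mul_le_mul_right (ht j) _) _
    _ = t * ∑ j, (‖α j‖ₑ + s) + s * ∑ _j : Fin n, ENNReal.ofReal κ := by
        rw [Finset.sum_add_distrib, ← Finset.sum_mul, ← Finset.mul_sum, mul_comm]

lemma lintegral_sqrt_networkKernel_ne_top (hb : SlowlyDecaying b) (D : Measure (UnitSphere d))
    [IsProbabilityMeasure D] {V : Fin m → EuclideanSpace ℝ (Fin d) × ℝ}
    (hV : ∫⁻ z, ‖networkKernel σ V z z - dotKernel b z z‖ₑ ∂D ≠ ⊤) :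
    ∫⁻ z, ENNReal.ofReal √(networkKernel σ V z z) ∂D ≠ ⊤ := by
  have hb0 : 0 ≤ ∑' k, b k := tsum_nonneg fun k => (hb.pos k).le
  refine ne_top_of_le_ne_top (ENNReal.add_ne_top.2 ⟨ENNReal.add_ne_top.2 ⟨ENNReal.one_ne_top,
    ENNReal.ofReal_ne_top (r := ∑' k, b k)⟩, hV⟩) ?_
  calc ∫⁻ z, ENNReal.ofReal √(networkKernel σ V z z) ∂D
      ≤ ∫⁻ z, (1 + ENNReal.ofReal (∑' k, b k) +
          ‖networkKernel σ V z z - dotKernel b z z‖ₑ) ∂D := by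
        refine lintegral_mono fun z => ?_
        -- `√s ≤ 1 + k + |s - k|` for the kernel `k ≥ 0` on the diagonal
        rw [← ofReal_norm, ← ENNReal.ofReal_one, ← ENNReal.ofReal_add zero_le_one hb0,
          ← ENNReal.ofReal_add (by positivity) (norm_nonneg _)]
        refine ENNReal.ofReal_le_ofReal (Real.sqrt_le_iff.2 ⟨by positivity, ?_⟩)
        have h1 := le_abs_self (networkKernel σ V z z - dotKernel b z z)
        rw [dotKernel_self, ← Real.norm_eq_abs] at h1
        rw [dotKernel_self]
        nlinarith [norm_nonneg (networkKernel σ V z z - ∑' k, b k)]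
    _ = 1 + ENNReal.ofReal (∑' k, b k) +
          ∫⁻ z, ‖networkKernel σ V z z - dotKernel b z z‖ₑ ∂D := by
        rw [lintegral_add_left measurable_const, lintegral_const, measure_univ, mul_one]

/-- If the kernel interpolant of the fixed sample `x` is accurate, then so are, in the iterated
limit and with a probability over the hidden weights that tends to `1`, the trained networks. -/
theorem tendsto_measure_not_eventually_risk_lt [IsProbabilityMeasure ν] (hb : SlowlyDecaying b)
    (hσ : Measurable σ) (hK : HasNNGPKernel σ ν b) {L : ℝ → ℝ → ℝ} (hL : IsLoss L)
    (D : Measure (UnitSphere d)) [IsProbabilityMeasure D] {f : UnitSphere d → ℝ}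
    {x : Fin n → UnitSphere d} {α : Fin n → ℝ}
    (hα : IsInterpolating b x (fun i => f (x i)) α) {ε : ℝ≥0∞}
    (hrisk : risk L D f (fun z => ∑ j, α j * dotKernel b (x j) z) < ε) :
    Filter.Tendsto (fun m : ℕ => (Measure.pi fun _ : Fin m => ν)
      {V | ¬ ∀ᶠ η in nhdsWithin 0 (Set.Ioi 0), ∀ᶠ T in Filter.atTop,
        ∀ order : ℕ → Equiv.Perm (Fin n),
          risk L D f (networkModel σ V η order T x fun i => f (x i)) < ε})
      Filter.atTop (nhds 0) := by
  -- the Gram matrix may be singular, hence the use of `exists_perturbed_solution`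
  let H : Matrix (Fin n) (Fin n) ℝ := fun i j => dotKernel b (x i) (x j)
  have hcomm : ∀ p q : UnitSphere d, dotKernel b p q = dotKernel b q p := fun p q => by
    rw [dotKernel, dotKernel, real_inner_comm]
  have hHα : H.mulVec α = fun i => f (x i) := by
    ext i
    have h1 : H.mulVec α i = ∑ j, dotKernel b (x i) (x j) * α j := rfl
    have h2 : ∑ j, α j * dotKernel b (x j) (x i) = f (x i) := hα i
    rw [h1, ← h2]
    refine Finset.sum_congr rfl fun j _ => ?_
    rw [mul_comm, hcomm (x j)]
  obtain ⟨A, Φ, hHA, hΦ, hsolve⟩ := exists_perturbed_solution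
    (H := H) (by ext i j; exact hcomm _ _) hHα
  obtain ⟨gap, hgap0, hgap⟩ := ENNReal.lt_iff_exists_add_pos_lt.1 hrisk
  have hhalf : (gap : ℝ≥0∞) / 2 ≠ 0 :=
    (ENNReal.half_pos (ENNReal.coe_ne_zero.2 hgap0.ne')).ne'
  -- the tolerance `s` for the coefficients and `t` for the kernel
  obtain ⟨s, hs0, hs⟩ := ENNReal.exists_nnreal_pos_mul_lt
    (a := ∑ _j : Fin n, ENNReal.ofReal (∑' k, b k)) (ENNReal.sum_ne_top.2 fun _ _ =>
      ENNReal.ofReal_ne_top) hhalf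
  have hnear : ∀ᶠ H' in nhds H, (H'.transpose = H' → H' * A = 0 →
      H'.mulVec (Φ H') = fun i => f (x i)) ∧ dist (Φ H') α < s :=
    hsolve.and (hΦ.eventually (Metric.ball_mem_nhds α (by exact_mod_cast hs0)))
  have hnear' : ∃ r > 0, ∀ H' : Fin n → Fin n → ℝ, dist H' H < r →
      ((Matrix.transpose H' = H' → Matrix.of H' * A = 0 →
      Matrix.mulVec H' (Φ H') = fun i => f (x i)) ∧ dist (Φ H') α < s) :=
    Metric.eventually_nhds_iff.1 hnear
  obtain ⟨r, hr0, hr⟩ := hnear'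
  obtain ⟨t₁, ht₁0, ht₁⟩ := ENNReal.exists_nnreal_pos_mul_lt
    (a := ∑ j : Fin n, (‖α j‖ₑ + s)) (ENNReal.sum_ne_top.2 fun j _ =>
      ENNReal.add_ne_top.2 ⟨enorm_ne_top, ENNReal.coe_ne_top⟩) hhalf
  set t : ℝ≥0∞ := min t₁ (ENNReal.ofReal r) with ht
  have ht0 : t ≠ 0 := by
    rw [ht]
    exact (lt_min (by exact_mod_cast ht₁0) (ENNReal.ofReal_pos.2 hr0)).ne'
  have httop : t ≠ ⊤ := ne_top_of_le_ne_top ENNReal.coe_ne_top (min_le_left _ _)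
  have hKm := (continuous_dotKernel hb d).measurable
  have hGm : ∀ (m : ℕ), Measurable fun q : (Fin m → EuclideanSpace ℝ (Fin d) × ℝ) ×
      (UnitSphere d × UnitSphere d) =>
      ‖networkKernel σ q.1 q.2.1 q.2.2 - dotKernel b q.2.1 q.2.2‖ₑ := fun m =>
    ((Measurable.networkKernel hσ measurable_fst (by fun_prop) (by fun_prop)).sub
      (hKm.comp measurable_snd)).enorm
  have hmarkov : Filter.Tendsto (fun m : ℕ => (Measure.pi fun _ : Fin m => ν)
      {V | t ≤ ∫⁻ q, ‖networkKernel σ V q.1 q.2 - dotKernel b q.1 q.2‖ₑ ∂(testMeasure D x)})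
      Filter.atTop (nhds 0) := by
    have h := ENNReal.Tendsto.div_const
      (tendsto_lintegral_networkKernel_sub hb hσ hK (testMeasure D x)) (b := t) (Or.inr ht0)
    rw [ENNReal.zero_div] at h
    exact tendsto_of_tendsto_of_tendsto_of_le_of_le tendsto_const_nhds h (fun _ => zero_le)
      fun m => meas_ge_le_lintegral_div (hGm m).lintegral_prod_right'.aemeasurable ht0 httop
  refine tendsto_of_tendsto_of_tendsto_of_le_of_le tendsto_const_nhds hmarkov
    (fun _ => zero_le) fun m => ?_
  -- outside of a null set, the failure event is contained in the one of Markov's inequality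
  have hnull : ∀ᵐ V : Fin m → EuclideanSpace ℝ (Fin d) × ℝ ∂(Measure.pi fun _ => ν),
      ∀ k, ∑ j, A j k • hiddenLayer σ V (x j) = 0 :=
    ae_all_iff.2 fun k => ae_sum_smul_hiddenLayer_eq_zero hK x
      (fun i => congrFun (congrFun hHA i) k) m
  refine measure_mono_ae ?_
  filter_upwards [hnull] with V hV hbad
  by_contra hlt
  replace hlt := not_le.1 hlt
  refine hbad ?_
  set G := ∫⁻ q, ‖networkKernel σ V q.1 q.2 - dotKernel b q.1 q.2‖ₑ ∂(testMeasure D x) with hG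
  obtain ⟨hG1, hG2, hG3⟩ := le_lintegral_testMeasure D x
    ((hGm m).comp ((measurable_const (a := V)).prodMk measurable_id))
  let H' : Matrix (Fin n) (Fin n) ℝ := fun i j => networkKernel σ V (x i) (x j)
  have hdist : @dist (Fin n → Fin n → ℝ) _ H' H < r := by
    refine (dist_pi_lt_iff hr0).2 fun i => (dist_pi_lt_iff hr0).2 fun j => ?_
    have h1 : ‖H' i j - H i j‖ₑ < ENNReal.ofReal r :=
      ((hG1 i j).trans_lt hlt).trans_le (min_le_right _ _)
    rw [← ofReal_norm, ENNReal.ofReal_lt_ofReal_iff hr0] at h1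
    rwa [dist_eq_norm]
  obtain ⟨hsol, hclose⟩ := hr H' hdist
  have hH'A : H' * A = 0 := by
    ext i k
    have h1 : (H' * A) i k = hiddenLayer σ V (x i) ⬝ᵥ ∑ j, A j k • hiddenLayer σ V (x j) := by
      rw [Matrix.mul_apply, dotProduct_sum]
      refine Finset.sum_congr rfl fun j _ => ?_
      rw [dotProduct_smul, smul_eq_mul, mul_comm]
      rfl
    rw [h1, hV k, dotProduct_zero]
    rfl
  have hw := hsol (by ext i j; exact networkKernel_comm V _ _) hH'A
  set w := Φ H' with hwdef
  have hJ : ∫⁻ z, ENNReal.ofReal √(networkKernel σ V z z) ∂D ≠ ⊤ :=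
    lintegral_sqrt_networkKernel_ne_top hb D (hG3.trans_lt (hlt.trans_le le_top)).ne
  refine eventually_risk_networkModel_lt (w := w) hL hσ (fun i => ?_) hJ ?_
  · have h1 : f (x i) = ∑ j, H' i j * w j := (congrFun hw i).symm
    rw [h1]
    exact Finset.sum_congr rfl fun j _ => by
      rw [mul_comm, networkKernel_comm]
  have hmz : ∀ j, Measurable fun z => networkKernel σ V (x j) z := fun j =>
    Measurable.networkKernel hσ measurable_const measurable_const measurable_id
  have hkz : ∀ j, Measurable fun z => dotKernel b (x j) z := fun j =>
    hKm.of_uncurry_left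
  have hwα : ∀ j, ‖w j - α j‖ₑ ≤ s := fun j => by
    have h1 := (dist_le_pi_dist w α j).trans hclose.le
    rw [dist_eq_norm] at h1
    rw [← ofReal_norm, ← ENNReal.ofReal_coe_nnreal]
    exact ENNReal.ofReal_le_ofReal h1
  have hsum := (lintegral_enorm_sum_mul_sub_le D hmz hkz
    (fun j z => abs_dotKernel_le hb (x j) z) hwα
    fun j => (hG2 j).trans (hlt.le.trans (min_le_left _ _))).trans
      ((add_le_add ht₁.le hs.le).trans_eq (ENNReal.add_halves _))
  have hmeas : Measurable fun z => ∑ j, w j * networkKernel σ V (x j) z -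
      ∑ j, α j * dotKernel b (x j) z :=
    (Finset.measurable_sum _ fun j _ => (hmz j).const_mul _).sub
      (Finset.measurable_sum _ fun j _ => (hkz j).const_mul _)
  have hle := risk_le_add hL D f (fun z => ∑ j, α j * dotKernel b (x j) z)
    (fun z => ∑ j, w j * networkKernel σ V (x j) z) hmeas
  exact (hle.trans (add_le_add_right hsum _)).trans_lt hgap

end

/-! ### Measurability of the failure events and the transfer to networks -/

section

variable {d n m : ℕ} {σ : ℝ → ℝ}

lemma measurable_foldl_sgdStep {Z : Type*} [MeasurableSpace Z] (η : ℝ)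
    {h : Z → Fin n → Fin m → ℝ} (hh : ∀ i r, Measurable fun q => h q i r) {y : Z → Fin n → ℝ}
    (hy : ∀ i, Measurable fun q => y q i) (l : List (Fin n)) {w : Z → Fin m → ℝ}
    (hw : ∀ r, Measurable fun q => w q r) (r : Fin m) :
    Measurable fun q => l.foldl (sgdStep η (h q) (y q)) (w q) r := by
  induction l generalizing w with
  | nil => exact hw r
  | cons i l ih =>
    refine ih (w := fun q => sgdStep η (h q) (y q) (w q) i) fun r => ?_
    have hwh : Measurable fun q => ∑ s, w q s * h q i s :=
      Finset.measurable_sum _ fun s _ => (hw s).mul (hh i s)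
    exact (hw r).sub (((hwh.sub (hy i)).const_mul η).mul (hh i r))

lemma measurable_sgd {Z : Type*} [MeasurableSpace Z] (η : ℝ)
    {h : Z → Fin n → Fin m → ℝ} (hh : ∀ i r, Measurable fun q => h q i r) {y : Z → Fin n → ℝ}
    (hy : ∀ i, Measurable fun q => y q i) (order : ℕ → Equiv.Perm (Fin n)) (T : ℕ) (r : Fin m) :
    Measurable fun q => sgd η (h q) (y q) order T r := by
  induction T generalizing r with
  | zero => exact measurable_const
  | succ T ih => exact measurable_foldl_sgdStep η hh hy _ ih r

lemma measurableSet_le_risk_networkModel (hσ : Measurable σ) {L : ℝ → ℝ → ℝ} (hL : IsLoss L)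
    (D : Measure (UnitSphere d)) [IsProbabilityMeasure D] {f : UnitSphere d → ℝ}
    (hf : Measurable f) (ε : ℝ≥0∞) (η : ℝ) (order : ℕ → Equiv.Perm (Fin n)) (T : ℕ) :
    MeasurableSet {θ : (Fin m → EuclideanSpace ℝ (Fin d) × ℝ) × (Fin n → UnitSphere d) |
      ε ≤ risk L D f (networkModel σ θ.1 η order T θ.2 fun i => f (θ.2 i))} := by
  refine measurableSet_le measurable_const ?_
  have hmodel : Measurable fun q : ((Fin m → EuclideanSpace ℝ (Fin d) × ℝ) ×
      (Fin n → UnitSphere d)) × UnitSphere d =>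
      networkModel σ q.1.1 η order T q.1.2 (fun i => f (q.1.2 i)) q.2 := by
    refine Finset.measurable_sum _ fun r _ => Measurable.mul ?_ ?_
    · exact measurable_sgd η
        (h := fun q : ((Fin m → EuclideanSpace ℝ (Fin d) × ℝ) ×
          (Fin n → UnitSphere d)) × UnitSphere d => fun i => hiddenLayer σ q.1.1 (q.1.2 i))
        (fun i r => Measurable.hiddenLayer hσ (by fun_prop) (by fun_prop) r)
        (fun i => hf.comp (by fun_prop)) order T r
    · exact Measurable.hiddenLayer hσ (by fun_prop) (by fun_prop) r
  have hloss := hL.measurable.comp ((hf.comp measurable_snd).prodMk hmodel)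
  exact hloss.ennreal_ofReal.lintegral_prod_right'

/-- Whenever kernel learning succeeds with a number of examples, so do wide networks with the
same kernel: the failure probability is a strict inequality, and the errors of the networks
are eventually below `ε` for every sample for which the error of the kernel model is. -/
theorem NetworkLearns.of_kernelLearns {b : ℕ → ℝ} (hb : SlowlyDecaying b) (hσ : Measurable σ)
    {ν : Measure (EuclideanSpace ℝ (Fin d) × ℝ)} [IsProbabilityMeasure ν]
    (hK : HasNNGPKernel σ ν b) {L : ℝ → ℝ → ℝ} (hL : IsLoss L) (D : Measure (UnitSphere d))
    [IsProbabilityMeasure D] {f : UnitSphere d → ℝ} (hf : Measurable f)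
    (hint : ∀ x : Fin n → UnitSphere d, ∃ α, IsInterpolating b x (fun i => f (x i)) α) {ε δ : ℝ}
    (h : KernelLearns b L f D ε δ n) : NetworkLearns σ ν L f D ε δ n := by
  have key := eventually_measure_prod_lt (ν := fun m => Measure.pi fun _ : Fin m => ν)
    (O := ℕ → Equiv.Perm (Fin n))
    (fun m η T o => measurableSet_le_risk_networkModel (m := m) hσ hL D hf (ENNReal.ofReal ε) η o T)
    h ?_
  · obtain ⟨m₀, hm₀⟩ := Filter.eventually_atTop.1 key
    refine ⟨m₀, fun m hm => ?_⟩
    obtain ⟨η₀, hη₀, hsub⟩ := mem_nhdsGT_iff_exists_Ioc_subset.1 (hm₀ m hm)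
    exact ⟨η₀, hη₀, fun η h0 hη => Filter.eventually_atTop.1 (hsub ⟨h0, hη⟩)⟩
  · intro x hx
    have hx' : risk L D f (kernelModel b x fun i => f (x i)) < ENNReal.ofReal ε := not_le.1 hx
    rw [kernelModel, dif_pos (hint x)] at hx'
    have h1 := tendsto_measure_not_eventually_risk_lt hb hσ hK hL D (hint x).choose_spec hx'
    simpa only [Set.mem_ofPred, not_le] using h1

end

/-! ### Sample complexity -/

section

variable {E : Type*} [NormedAddCommGroup E] [InnerProductSpace ℝ E]

lemma kernelLearns_of_lt_of_loss_le {b : ℕ → ℝ} (hb : SlowlyDecaying b) {d : ℕ}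
    {φ : UnitSphere d → E} (hφ : ∀ x y, inner ℝ (φ x) (φ y) = dotKernel b x y)
    {f : UnitSphere d → ℝ} {a : E} (ha : ∀ x, inner ℝ a (φ x) = f x) {L : ℝ → ℝ → ℝ}
    (hL : IsLoss L) {B C M : ℝ} (hB : 0 < B) (hLB : ∀ y z, L y z ≤ B) (hCB : 16 * B ^ 2 ≤ C)
    (hM : 0 ≤ M) (hCM : 128 * (‖a‖ * √(∑' k, b k)) ^ 2 ≤ C * M)
    (D : Measure (UnitSphere d)) [IsProbabilityMeasure D] {ε δ : ℝ} (hε : 0 < ε) (hδ : 0 < δ)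
    (hδ1 : δ < 1) {n : ℕ} (hn : C * ((M + Real.log δ⁻¹) / ε ^ 2) < n + 1) :
    KernelLearns b L f D ε δ n :=
  kernelLearns_of_le hb hφ ha hL D hε hδ hB (Or.inl hLB) fun hA =>
    sample_size_estimates hε (Real.log_nonneg ((one_le_inv₀ hδ).2 hδ1.le)) hCB hCM hM hn hA

/-- For arbitrary losses, the bound `‖a‖ √K(x, x)` for the errors of the kernel models takes the place
of the bound for the loss. -/
lemma kernelLearns_of_lt {b : ℕ → ℝ} (hb : SlowlyDecaying b) {d : ℕ}
    {φ : UnitSphere d → E} (hφ : ∀ x y, inner ℝ (φ x) (φ y) = dotKernel b x y)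
    {f : UnitSphere d → ℝ} {a : E} (ha : ∀ x, inner ℝ a (φ x) = f x) {L : ℝ → ℝ → ℝ}
    (hL : IsLoss L) {C M : ℝ} (hCM : 128 * (‖a‖ * √(∑' k, b k)) ^ 2 ≤ C * M)
    (D : Measure (UnitSphere d)) [IsProbabilityMeasure D] {ε δ : ℝ} (hε : 0 < ε) (hδ : 0 < δ)
    (hδ1 : δ < 1) {n : ℕ} (hn : C * (M * (1 + Real.log δ⁻¹) / ε ^ 2) < n + 1) :
    KernelLearns b L f D ε δ n := by
  refine kernelLearns_of_le hb hφ ha hL D hε hδ (B := max (‖a‖ * √(∑' k, b k)) ε)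
    (lt_max_of_lt_right hε) (Or.inr (le_max_left _ _)) fun hA => ?_
  rw [max_eq_left hA]
  refine sample_size_estimates (C := C * M) (M := 1) hε
    (Real.log_nonneg ((one_le_inv₀ hδ).2 hδ1.le)) ?_ (by rwa [mul_one]) zero_le_one ?_ hA
  · nlinarith [sq_nonneg (‖a‖ * √(∑' k, b k))]
  · rwa [mul_assoc, ← mul_div_assoc]

end

end

theorem mainTheorem1 :
    -- the neural tangent kernel of the ReLU network with bias is slowly decaying
    (∃ b : ℕ → ℝ, SlowlyDecaying b ∧
      ∀ t ∈ Set.Icc (-1 : ℝ) 1, HasSum (fun k => b k * t ^ k) (reluBiasNTK t)) ∧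
    -- every slowly decaying kernel learns analytic functions of `β ⬝ x` efficiently;
    -- `C` depends only on the kernel and on a bound `B` for the loss
    ∀ b : ℕ → ℝ, SlowlyDecaying b → ∀ B : ℝ, ∃ C : ℝ, 0 < C ∧
      ∀ (g : ℝ → ℝ) (p : FormalMultilinearSeries ℝ ℝ ℝ) (R : ℝ≥0∞),
        HasFPowerSeriesOnBall g p 0 R →
      ∀ (d : ℕ) (β : EuclideanSpace ℝ (Fin d)), ‖β‖ₑ < R →
        DifferentiableAt ℝ (tildeFun p) ‖β‖ ∧
        ∀ (L : ℝ → ℝ → ℝ), IsLoss L →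
          -- losses bounded by `B`: efficient learnability with `√M = ‖β‖ g̃'(‖β‖) + g̃(0)`
          ((∀ y z, L y z ≤ B) →
            EfficientlyLearned
                (KernelLearns b L fun x : UnitSphere d => g (inner ℝ β x.1))
                C (sqrtM p ‖β‖ ^ 2) ∧
            ∀ (σ : ℝ → ℝ) (ν : Measure (EuclideanSpace ℝ (Fin d) × ℝ)),
              Measurable σ → IsProbabilityMeasure ν → HasNNGPKernel σ ν b →
              EfficientlyLearned
                (NetworkLearns σ ν L fun x : UnitSphere d => g (inner ℝ β x.1))
                C (sqrtM p ‖β‖ ^ 2)) ∧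
          -- arbitrary losses: `O(M (1 + log (1/δ)) / ε²)` examples suffice
          (HasSampleBound
                (KernelLearns b L fun x : UnitSphere d => g (inner ℝ β x.1))
                (fun ε δ => C * (sqrtM p ‖β‖ ^ 2 * (1 + Real.log δ⁻¹) / ε ^ 2)) ∧
            ∀ (σ : ℝ → ℝ) (ν : Measure (EuclideanSpace ℝ (Fin d) × ℝ)),
              Measurable σ → IsProbabilityMeasure ν → HasNNGPKernel σ ν b →
              HasSampleBound
                (NetworkLearns σ ν L fun x : UnitSphere d => g (inner ℝ β x.1))
                (fun ε δ => C * (sqrtM p ‖β‖ ^ 2 * (1 + Real.log δ⁻¹) / ε ^ 2))) := by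
  refine ⟨reluBiasNTK_slowlyDecaying, fun b hb B => ?_⟩
  obtain ⟨c, hc, hbc⟩ := hb.lower
  have hb0 : 0 ≤ ∑' k, b k := tsum_nonneg fun k => (hb.pos k).le
  have hB : 0 < max B 1 := lt_max_of_lt_right one_pos
  -- `128 ‖a‖² K(x, x) ≤ 512 K(x, x) M / c`, as `‖a‖² ≤ 4 M / c`
  set C : ℝ := 512 * (∑' k, b k) / c + 16 * max B 1 ^ 2 with hC
  refine ⟨C, by positivity, fun g p R hg d β hβ =>
    ⟨tildeFun_differentiableAt hg (norm_nonneg β) (by rwa [ofReal_norm]), fun L hL => ?_⟩⟩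
  obtain ⟨φ, a, hφ, ha, han⟩ := exists_featureMap hb hc hbc hg hβ
  have hCB : 16 * max B 1 ^ 2 ≤ C := le_add_of_nonneg_left (by positivity)
  have hCM : 128 * (‖a‖ * √(∑' k, b k)) ^ 2 ≤ C * sqrtM p ‖β‖ ^ 2 := by
    calc 128 * (‖a‖ * √(∑' k, b k)) ^ 2 = 128 * (∑' k, b k) * ‖a‖ ^ 2 := by
          rw [mul_pow, Real.sq_sqrt hb0]
          ring
      _ ≤ 128 * (∑' k, b k) * (4 / c * sqrtM p ‖β‖ ^ 2) :=
          mul_le_mul_of_nonneg_left han (by positivity)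
      _ = 512 * (∑' k, b k) / c * sqrtM p ‖β‖ ^ 2 := by ring
      _ ≤ C * sqrtM p ‖β‖ ^ 2 :=
          mul_le_mul_of_nonneg_right (le_add_of_nonneg_right (by positivity)) (sq_nonneg _)
  have hf : Measurable fun x : UnitSphere d => g (inner ℝ β x.1) := by
    simp_rw [← ha]
    exact (continuous_const.inner (continuous_featureMap hb hφ)).measurable
  have hnet : ∀ (σ : ℝ → ℝ) (ν : Measure (EuclideanSpace ℝ (Fin d) × ℝ)), Measurable σ →
      IsProbabilityMeasure ν → HasNNGPKernel σ ν b → ∀ D : Measure (UnitSphere d),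
      IsProbabilityMeasure D → ∀ (ε δ : ℝ) (n : ℕ),
      KernelLearns b L (fun x : UnitSphere d => g (inner ℝ β x.1)) D ε δ n →
      NetworkLearns σ ν L (fun x : UnitSphere d => g (inner ℝ β x.1)) D ε δ n :=
    fun σ ν hσ _ hK D _ ε δ n =>
      NetworkLearns.of_kernelLearns hb hσ hK hL D hf (exists_isInterpolating hφ ha)
  have hunb := fun (D : Measure (UnitSphere d)) (_ : IsProbabilityMeasure D) (ε δ : ℝ)
      (hε : 0 < ε) (hδ : 0 < δ) (hδ1 : δ < 1) (n : ℕ) =>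
    kernelLearns_of_lt hb hφ ha hL hCM D hε hδ hδ1 (n := n)
  refine ⟨fun hLB => ?_, hasSampleBound_of_forall hunb, fun σ ν hσ hν hK =>
    hasSampleBound_of_forall fun D hD ε δ hε hδ hδ1 n hn =>
      hnet σ ν hσ hν hK D hD ε δ n (hunb D hD ε δ hε hδ hδ1 n hn)⟩
  have hbdd := fun (D : Measure (UnitSphere d)) (_ : IsProbabilityMeasure D) (ε δ : ℝ)
      (hε : 0 < ε) (hδ : 0 < δ) (hδ1 : δ < 1) (n : ℕ) =>
    kernelLearns_of_lt_of_loss_le hb hφ ha hL hB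
      (fun y z => (hLB y z).trans (le_max_left B 1)) hCB (sq_nonneg _) hCM D hε hδ hδ1 (n := n)
  exact ⟨hasSampleBound_of_forall hbdd, fun σ ν hσ hν hK =>
    hasSampleBound_of_forall fun D hD ε δ hε hδ hδ1 n hn =>
      hnet σ ν hσ hν hK D hD ε δ n (hbdd D hD ε δ hε hδ hδ1 n hn)⟩
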